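/- A $*$-probability space is a pair $(\mathcal A,\varphi)$ of a unital complex $*$-algebra $\mathcal A$ and a complex linear functional $\varphi$ on $\mathcal A$ with $\varphi(1)=1$. A standard complex Gaussian variable in it is a normal, non self-adjoint $a\in\mathcal A$ with $\varphi(a^p a^{*q})=\mathbb E[N^p\overline{N}^{\,q}]$ for all integers $p,q\ge 0$, where $N=X+\mathrm{i}Y$ and $X,Y$ are independent real Gaussian random variables with mean $0$ and variance $1/2$. Variables $a_1,\dots,a_k\in\mathcal A$ are independent if for all $i\ne j$ the variable $a_i$ commutes with $a_j$ and with $a_j^*$, and $\varphi\big(\prod_{j=1}^k a_j^{p_j}a_j^{*q_j}\big)=\prod_{j=1}^k\varphi(a_j^{p_j}a_j^{*q_j})$ for all integers $p_j,q_j\ge 0$. For $n\ge1$ and real $s_0,\dots,s_{n-1}$, the skew-circulant matrix $S_n=\mathrm{Scirc}(s_0,\dots,s_{n-1})$ is the $n\times n$ matrix whose $(i,j)$ entry, $0\le i,j\le n-1$, is $s_{j-i}$ if $i\le j$ and $-s_{n+j-i}$ if $i>j$. **Theorem.** Let $k\in\mathbb N$, and let $(s^{(j)}_r)_{r\ge0}$,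 $j=1,\dots,k$, be independent sequences of real random variables on one probability space. Suppose that for each $j$ the variables $s^{(j)}_r$, $r\ge0$, are independent, with mean $0$, variance $1$ and $\sup_{r}\mathbb E|s^{(j)}_r|^p<\infty$ for every integer $p\ge1$. Let $S_n^{(j)}=\mathrm{Scirc}(s^{(j)}_0,\dots,s^{(j)}_{n-1})$, so that $S_n^{(1)},\dots,S_n^{(k)}$ are independent random skew-circulant matrices. Regard $n^{-1/2}S_n^{(j)}$ as elements of the $*$-probability space $(\mathcal M_n,\varphi_n)$ of random $n\times n$ complex matrices whose entries have finite moments of all orders, with $\varphi_n=n^{-1}\mathbb E\,\mathrm{Tr}$. Then $\{n^{-1/2}S_n^{(j)}\}_{1\le j\le k}$ converge jointly in $*$-distribution to independent standard complex Gaussian variables. That is, some $*$-probability space contains $k$ independent standard complex Gaussian variables, and for any such variables $N_1,\dots,N_k$ in any $*$-probability space $(\mathcal A,\varphi)$ and every monomial $Q$ in the non-commuting indeterminates $x_1,x_1^*,\dots,x_k,x_k^*$, $$\lim_{n\to\infty}\varphi_n\big(Q(n^{-1/2}S_n^{(1)},\dots,n^{-1/2}S_n^{(k)})\big)=\varphi\big(Q(N_1,\dots,N_k)\big).$$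 -/

import Mathlib

open MeasureTheory ProbabilityTheory Filter
open scoped Topology ENNReal ComplexConjugate

universe u v

/-- A non-commutative `*`-probability space: a unital complex `*`-algebra with a complex linear
functional (the state) that maps the identity to `1`. -/
structure StarProbSpace where
  /-- The underlying `*`-algebra. -/
  carrier : Type u
  [ring : Ring carrier]
  [starRing : StarRing carrier]
  [algebra : Algebra ℂ carrier]
  [starModule : StarModule ℂ carrier]
  /-- The state. -/
  state : carrier →ₗ[ℂ] ℂ
  state_one : state 1 = 1

attribute [instance] StarProbSpace.ring StarProbSpace.starRing StarProbSpace.algebra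
  StarProbSpace.starModule

/-- The monomial in `x j`, `star (x j)` given by a word: the letter `(j, false)` stands for `x j`
and the letter `(j, true)` for `star (x j)`. The empty word gives `1`. -/
def starMonomial {A : Type u} [Ring A] [StarRing A] {k : ℕ} (x : Fin k → A)
    (w : List (Fin k × Bool)) : A :=
  (w.map fun l => if l.2 then star (x l.1) else x l.1).prod

/-- Joint convergence in `*`-distribution: the state of every `*`-monomial converges. -/
def ConvergesInStarDistribution {k : ℕ} (A : ℕ+ → StarProbSpace.{u})
    (a : (n : ℕ+) → Fin k → (A n).carrier) (B : StarProbSpace.{v}) (b : Fin k → B.carrier) : Prop :=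
  ∀ w : List (Fin k × Bool),
    Tendsto (fun n => (A n).state (starMonomial (a n) w)) atTop (𝓝 (B.state (starMonomial b w)))

/-- The moment `E[N ^ p * conj N ^ q]` of `N = X + i Y`, where `X` and `Y` are independent real
Gaussian random variables of mean `0` and variance `1 / 2`. -/
noncomputable def complexGaussianMoment (p q : ℕ) : ℂ :=
  ∫ z : ℝ × ℝ, ((z.1 : ℂ) + (z.2 : ℂ) * Complex.I) ^ p *
      conj ((z.1 : ℂ) + (z.2 : ℂ) * Complex.I) ^ q
    ∂((gaussianReal 0 (1 / 2)).prod (gaussianReal 0 (1 / 2)))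

/-- A standard complex Gaussian variable of a `*`-probability space: a non self-adjoint normal
element whose `*`-moments are those of a standard complex Gaussian random variable. -/
structure IsStandardComplexGaussian (B : StarProbSpace.{u}) (a : B.carrier) : Prop where
  not_selfAdjoint : ¬ IsSelfAdjoint a
  normal : IsStarNormal a
  moments : ∀ p q : ℕ, B.state (a ^ p * star a ^ q) = complexGaussianMoment p q

/-- Independence of the variables `a 0, …, a (k - 1)`: different variables commute with each other
and with each other's adjoints, and joint moments factorize. (The two remaining commutation
relations, of the adjoints, follow by taking `star`.) -/
structure StarIndependent (B : StarProbSpace.{u}) {k : ℕ} (a : Fin k → B.carrier) : Prop where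
  commute : ∀ i j, i ≠ j → Commute (a i) (a j)
  commute_star : ∀ i j, i ≠ j → Commute (a i) (star (a j))
  factorize : ∀ p q : Fin k → ℕ,
    B.state (List.ofFn fun j => a j ^ p j * star (a j) ^ q j).prod =
      ∏ j, B.state (a j ^ p j * star (a j) ^ q j)

section RandomMatrices

variable {Ω : Type u} [MeasurableSpace Ω]

theorem memLp_mul_of_forall_nat {μ : Measure Ω} {f g : Ω → ℂ}
    (hf : ∀ p : ℕ, MemLp f p μ) (hg : ∀ p : ℕ, MemLp g p μ) (p : ℕ) :
    MemLp (fun ω => f ω * g ω) p μ := by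
  have : ENNReal.HolderTriple ((2 * p : ℕ) : ℝ≥0∞) ((2 * p : ℕ) : ℝ≥0∞) (p : ℝ≥0∞) := by
    constructor
    push_cast
    rw [ENNReal.mul_inv (by simp) (by simp), ← add_mul, ENNReal.inv_two_add_inv_two, one_mul]
  exact (hg (2 * p)).mul' (hf (2 * p))

/-- The `*`-algebra of random `n × n` complex matrices all of whose entries have finite absolute
moments of all orders, with the pointwise operations; `star` is the conjugate transpose. -/
def randomMatrices (μ : Measure Ω) [IsProbabilityMeasure μ] (n : ℕ) :
    StarSubalgebra ℂ (Ω → Matrix (Fin n) (Fin n) ℂ) where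
  carrier := {X | ∀ i j, ∀ p : ℕ, MemLp (fun ω => X ω i j) p μ}
  mul_mem' := by
    intro X Y hX hY i j p
    simp only [Pi.mul_apply, Matrix.mul_apply]
    exact memLp_finsetSum _ fun l _ =>
      memLp_mul_of_forall_nat (hX i l) (hY l j) p
  add_mem' := by
    intro X Y hX hY i j p
    exact (hX i j p).add (hY i j p)
  algebraMap_mem' := by
    intro c i j p
    exact memLp_const ((algebraMap ℂ (Matrix (Fin n) (Fin n) ℂ) c) i j)
  star_mem' := by
    intro X hX i j p
    exact (hX j i p).star

theorem randomMatrices_integrable_entry (μ : Measure Ω) [IsProbabilityMeasure μ] (n : ℕ)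
    (X : randomMatrices μ n) (i j : Fin n) : Integrable (fun ω => X.1 ω i j) μ := by
  have h := X.2 i j 1
  rw [Nat.cast_one] at h
  exact memLp_one_iff_integrable.1 h

theorem randomMatrices_integrable_trace (μ : Measure Ω) [IsProbabilityMeasure μ] (n : ℕ)
    (X : randomMatrices μ n) : Integrable (fun ω => (X.1 ω).trace) μ := by
  simp only [Matrix.trace, Matrix.diag_apply]
  exact integrable_finsetSum _ fun i _ => randomMatrices_integrable_entry μ n X i i

/-- The `*`-probability space of random `n × n` matrices with the normalized expected trace. -/
noncomputable def randomMatrixSpace (μ : Measure Ω) [IsProbabilityMeasure μ] (n : ℕ+) :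
    StarProbSpace.{u} where
  carrier := randomMatrices μ n
  state :=
    { toFun := fun X => ((n : ℕ) : ℂ)⁻¹ * ∫ ω, (X.1 ω).trace ∂μ
      map_add' := by
        intro X Y
        have h : ∀ ω, ((X + Y).1 ω).trace = (X.1 ω).trace + (Y.1 ω).trace :=
          fun ω => Matrix.trace_add _ _
        simp only [h]
        rw [integral_add (randomMatrices_integrable_trace μ n X)
          (randomMatrices_integrable_trace μ n Y), mul_add]
      map_smul' := by
        intro c X
        have h : ∀ ω, ((c • X).1 ω).trace = c * (X.1 ω).trace :=
          fun ω => Matrix.trace_smul c (X.1 ω)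
        simp only [h]
        rw [integral_const_mul, RingHom.id_apply, smul_eq_mul]
        ring }
  state_one := by
    have h : ∀ ω, ((1 : randomMatrices μ n).1 ω).trace = ((n : ℕ) : ℂ) := by
      intro ω
      change (1 : Matrix (Fin n) (Fin n) ℂ).trace = _
      simp
    simp only [LinearMap.coe_mk, AddHom.coe_mk, h]
    simp

/-- The skew-circulant matrix with first row `s 0, …, s (n - 1)`: each row is the previous one
shifted cyclically to the right, with the sign of the entry that wraps around reversed. -/
def skewCirculant (n : ℕ) (s : ℕ → ℝ) : Matrix (Fin n) (Fin n) ℝ :=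
  Matrix.of fun i j =>
    if i ≤ j then s ((j : ℕ) - (i : ℕ)) else -s (n + (j : ℕ) - (i : ℕ))

/-- Conditions on a real input sequence: independent, mean zero, variance one, and for every order
the absolute moments are finite and bounded uniformly along the sequence. -/
structure IsInputSequence (s : ℕ → Ω → ℝ) (μ : Measure Ω) : Prop where
  measurable : ∀ r, Measurable (s r)
  indep : iIndepFun s μ
  memLp : ∀ r, ∀ p : ℕ, MemLp (s r) p μ
  mean : ∀ r, ∫ ω, s r ω ∂μ = 0
  variance : ∀ r, Var[s r; μ] = 1
  bounded : ∀ p : ℕ, ∃ M : ℝ, ∀ r, ∫ ω, |s r ω| ^ p ∂μ ≤ M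

/-- The random matrix `n ^ (-1/2) S_n`, where `S_n` is the skew-circulant matrix generated by
`s 0, …, s (n - 1)`, as an element of the space of random `n × n` matrices. -/
noncomputable def scaledSkewCirculant (μ : Measure Ω) [IsProbabilityMeasure μ] (s : ℕ → Ω → ℝ)
    (hs : IsInputSequence s μ) (n : ℕ+) : (randomMatrixSpace μ n).carrier :=
  (⟨fun ω => ((Real.sqrt n)⁻¹ • skewCirculant n fun r => s r ω).map Complex.ofReal, by
    intro i j p
    simp only [Matrix.map_apply, Matrix.smul_apply, skewCirculant, Matrix.of_apply, smul_eq_mul]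
    refine MemLp.ofReal (MemLp.const_mul ?_ _)
    split_ifs
    · exact hs.memLp _ p
    · exact (hs.memLp _ p).neg⟩ : randomMatrices μ n)

end RandomMatrices

/-! Skew-circulant matrices are the real polynomials in a signed shift whose n-th power is -1, so
they share the eigenvectors (ω^i), one for each n-th root ω of -1. The matrix F of these vectors
satisfies F F* = F* F = n, so the adjoints are diagonalised too. The eigenvalue of the scaled matrix
at ω is λ = ∑ c_r s_r with c_r = n^(-1/2) ω^r. A *-moment of the k matrices is thus an average over
ω, and independence of the sequences turns each term into a product over j of mixed moments E[λ^p
conj(λ)^q] (`state_starMonomial_scaledSkewCirculant`).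

These moments m(p,q) obey a quantitative central limit theorem
(`IsInputSequence.exists_norm_moment_sub_factorial_le`), proved by a Stein-type argument. Write
m(p+1,q) = ∑ c_r E[s_r λ^p conj(λ)^q] and expand each expectation around λ - c_r s_r, which is
independent of s_r. Mean 0 kills the constant term, variance 1 evaluates the linear one, and the
remainders sum to O(n^(-1/2)). Hence m(p+1,q) is close to p (∑ c_r²) m(p-1,q) + q (∑ |c_r|²)
m(p,q-1). Here ∑ |c_r|² = 1, while ∑ c_r² is a geometric sum that vanishes unless ω = -1. The
recursion yields p! for p = q and 0 otherwise, which are the moments of N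
(`complexGaussianMoment_eq`). The single exceptional ω has weight 1/n in the average, so the total
error is O(n^(-1/2)) (`exists_norm_state_sub_le`).

On the limit side all variables and adjoints commute, so a word can be sorted and its state
factorises into the same numbers (`StarIndependent.state_starMonomial`). -/

/-! ### Mixed monomials in z and conj z, and their Taylor bounds -/

/-- The monomial `z ^ p * conj z ^ q`. -/
noncomputable def mixedPow (p q : ℕ) (z : ℂ) : ℂ := z ^ p * conj z ^ q

theorem mixedPow_succ_left (p q : ℕ) (z : ℂ) : mixedPow (p + 1) q z = z * mixedPow p q z := by
  simp only [mixedPow]; ring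

theorem mixedPow_succ_right (p q : ℕ) (z : ℂ) :
    mixedPow p (q + 1) z = conj z * mixedPow p q z := by
  simp only [mixedPow]; ring

@[simp] theorem mixedPow_zero_zero (z : ℂ) : mixedPow 0 0 z = 1 := by simp [mixedPow]

theorem conj_mixedPow (p q : ℕ) (z : ℂ) : conj (mixedPow p q z) = mixedPow q p z := by
  simp [mixedPow, mul_comm]

theorem norm_mixedPow (p q : ℕ) (z : ℂ) : ‖mixedPow p q z‖ = ‖z‖ ^ (p + q) := by
  simp [mixedPow, pow_add]

theorem mixedPow_self (p : ℕ) (z : ℂ) : mixedPow p p z = ((‖z‖ ^ (2 * p) : ℝ) : ℂ) := by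
  rw [mixedPow, ← mul_pow, Complex.mul_conj, Complex.normSq_eq_norm_sq, pow_mul]
  push_cast
  rfl

theorem continuous_mixedPow (p q : ℕ) : Continuous (mixedPow p q) := by
  unfold mixedPow
  fun_prop

/-- Induction step of the first order bound, from a'F' - aF = a'(F' - F) + (a' - a)F. -/
theorem norm_mul_sub_mul_le_of_le {a a' F F' : ℂ} {x W : ℝ} {m : ℕ} (ha' : ‖a'‖ ≤ W)
    (hd : ‖a' - a‖ ≤ x) (hF : ‖F' - F‖ ≤ m * x * W ^ (m - 1)) (hF0 : ‖F‖ ≤ W ^ m) :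
    ‖a' * F' - a * F‖ ≤ (m + 1 : ℕ) * x * W ^ m := by
  have hW : 0 ≤ W := (norm_nonneg _).trans ha'
  have hx : 0 ≤ x := (norm_nonneg _).trans hd
  have e : a' * F' - a * F = a' * (F' - F) + (a' - a) * F := by ring
  -- The truncated exponent m - 1 is harmless at m = 0, where the factor m vanishes.
  have e1 : W * (m * x * W ^ (m - 1)) = m * x * W ^ m := by
    cases m with
    | zero => simp
    | succ k => rw [Nat.add_sub_cancel, pow_succ]; ring
  rw [e]
  calc _ ≤ ‖a' * (F' - F)‖ + ‖(a' - a) * F‖ := norm_add_le _ _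
    _ ≤ W * (m * x * W ^ (m - 1)) + x * W ^ m := by
        rw [norm_mul, norm_mul]; gcongr
    _ = _ := by rw [e1]; push_cast; ring

theorem norm_le_one_add_norm_add_norm (y z : ℂ) : ‖y + z‖ ≤ 1 + ‖y‖ + ‖z‖ := by
  linarith [norm_add_le y z]

theorem norm_mixedPow_le (p q : ℕ) (y : ℂ) {x : ℝ} (hx : 0 ≤ x) :
    ‖mixedPow p q y‖ ≤ (1 + ‖y‖ + x) ^ (p + q) := by
  rw [norm_mixedPow]
  gcongr
  linarith

/-- First order Taylor bound for `mixedPow`. -/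
theorem norm_mixedPow_add_sub_le (p q : ℕ) (y z : ℂ) :
    ‖mixedPow p q (y + z) - mixedPow p q y‖ ≤
      (p + q : ℕ) * ‖z‖ * (1 + ‖y‖ + ‖z‖) ^ (p + q - 1) := by
  induction q with
  | zero =>
    induction p with
    | zero => simp
    | succ p ih =>
      rw [mixedPow_succ_left, mixedPow_succ_left]
      exact norm_mul_sub_mul_le_of_le (norm_le_one_add_norm_add_norm y z) (by simp) ih
        (norm_mixedPow_le p 0 y (norm_nonneg z))
  | succ q ih =>
    rw [mixedPow_succ_right, mixedPow_succ_right]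
    refine norm_mul_sub_mul_le_of_le (m := p + q) ?_ ?_ ih
      (norm_mixedPow_le p q y (norm_nonneg z))
    · rw [RCLike.norm_conj]; exact norm_le_one_add_norm_add_norm y z
    · simp

/-- The differential of `mixedPow p q` at `y`, applied to `z`. -/
noncomputable def mixedPowDiff (p q : ℕ) (y z : ℂ) : ℂ :=
  p * z * mixedPow (p - 1) q y + q * conj z * mixedPow p (q - 1) y

theorem mixedPowDiff_succ_left (p q : ℕ) (y z : ℂ) :
    mixedPowDiff (p + 1) q y z = y * mixedPowDiff p q y z + z * mixedPow p q y := by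
  cases p with
  | zero => simp [mixedPowDiff, mixedPow]; ring
  | succ p => simp [mixedPowDiff, mixedPow]; ring

theorem mixedPowDiff_succ_right (p q : ℕ) (y z : ℂ) :
    mixedPowDiff p (q + 1) y z = conj y * mixedPowDiff p q y z + conj z * mixedPow p q y := by
  cases q with
  | zero => simp [mixedPowDiff, mixedPow]; ring
  | succ q => simp [mixedPowDiff, mixedPow]; ring

theorem norm_mixedPowDiff_le (p q : ℕ) (y z : ℂ) :
    ‖mixedPowDiff p q y z‖ ≤ (p + q : ℕ) * ‖z‖ * (1 + ‖y‖ + ‖z‖) ^ (p + q) := by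
  have hy : ‖y‖ ≤ 1 + ‖y‖ + ‖z‖ := by linarith [norm_nonneg z]
  have h1 : 1 ≤ 1 + ‖y‖ + ‖z‖ := by linarith [norm_nonneg z, norm_nonneg y]
  have hpow : ∀ i ≤ p + q, ‖y‖ ^ i ≤ (1 + ‖y‖ + ‖z‖) ^ (p + q) := fun i hi =>
    (pow_le_pow_left₀ (norm_nonneg y) hy i).trans (pow_le_pow_right₀ h1 hi)
  calc _ ≤ ‖(p : ℂ) * z * mixedPow (p - 1) q y‖ + ‖(q : ℂ) * conj z * mixedPow p (q - 1) y‖ :=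
        norm_add_le _ _
    _ = p * ‖z‖ * ‖y‖ ^ (p - 1 + q) + q * ‖z‖ * ‖y‖ ^ (p + (q - 1)) := by
        simp [norm_mixedPow]
    _ ≤ p * ‖z‖ * (1 + ‖y‖ + ‖z‖) ^ (p + q) + q * ‖z‖ * (1 + ‖y‖ + ‖z‖) ^ (p + q) := by
        gcongr <;> exact hpow _ (by omega)
    _ = _ := by push_cast; ring

/-- Leibniz rule for second order remainders: the new remainder is a'(F' - F - L) + dL, and m² + m ≤
(m + 1)². -/
theorem norm_mul_sub_mul_sub_le_of_le {a a' d F F' L : ℂ} {x W : ℝ} {m : ℕ} (ha' : ‖a'‖ ≤ W)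
    (hd : a' - a = d) (hdx : ‖d‖ ≤ x) (hF : ‖F' - F - L‖ ≤ (m : ℝ) ^ 2 * x ^ 2 * W ^ m)
    (hL : ‖L‖ ≤ m * x * W ^ m) (hW1 : 1 ≤ W) :
    ‖a' * F' - a * F - (a * L + d * F)‖ ≤ ((m + 1 : ℕ) : ℝ) ^ 2 * x ^ 2 * W ^ (m + 1) := by
  have hW : 0 ≤ W := (norm_nonneg _).trans ha'
  have hx : 0 ≤ x := (norm_nonneg _).trans hdx
  have e : a' * F' - a * F - (a * L + d * F) = a' * (F' - F - L) + d * L := by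
    rw [← hd]; ring
  have hWm : W ^ m ≤ W ^ (m + 1) := pow_le_pow_right₀ hW1 (by omega)
  rw [e]
  calc _ ≤ ‖a' * (F' - F - L)‖ + ‖d * L‖ := norm_add_le _ _
    _ ≤ W * ((m : ℝ) ^ 2 * x ^ 2 * W ^ m) + x * (m * x * W ^ m) := by
        rw [norm_mul, norm_mul]; gcongr
    _ = (m : ℝ) ^ 2 * x ^ 2 * W ^ (m + 1) + m * x ^ 2 * W ^ m := by ring
    _ ≤ (m : ℝ) ^ 2 * x ^ 2 * W ^ (m + 1) + m * x ^ 2 * W ^ (m + 1) := by gcongr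
    _ ≤ _ := by
        have : 0 ≤ x ^ 2 * W ^ (m + 1) := by positivity
        have hm : (0 : ℝ) ≤ m := by positivity
        push_cast
        nlinarith

/-- Second order Taylor bound for `mixedPow`. -/
theorem norm_mixedPow_add_sub_sub_le (p q : ℕ) (y z : ℂ) :
    ‖mixedPow p q (y + z) - mixedPow p q y - mixedPowDiff p q y z‖ ≤
      ((p + q : ℕ) : ℝ) ^ 2 * ‖z‖ ^ 2 * (1 + ‖y‖ + ‖z‖) ^ (p + q) := by
  have h1 : 1 ≤ 1 + ‖y‖ + ‖z‖ := by linarith [norm_nonneg z, norm_nonneg y]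
  induction q with
  | zero =>
    induction p with
    | zero => simp [mixedPowDiff]
    | succ p ih =>
      rw [mixedPow_succ_left, mixedPow_succ_left, mixedPowDiff_succ_left]
      exact norm_mul_sub_mul_sub_le_of_le (m := p) (norm_le_one_add_norm_add_norm y z) (by simp)
        le_rfl ih (norm_mixedPowDiff_le p 0 y z) h1
  | succ q ih =>
    rw [mixedPow_succ_right, mixedPow_succ_right, mixedPowDiff_succ_right]
    refine norm_mul_sub_mul_sub_le_of_le (m := p + q) ?_ ?_ ?_ ih
      (norm_mixedPowDiff_le p q y z) h1
    · rw [RCLike.norm_conj]; exact norm_le_one_add_norm_add_norm y z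
    · simp
    · simp

/-! ### Functions with moments of all orders -/

/-- Functions with finite absolute moments of all orders. -/
def MemAllLp {Ω E : Type*} [MeasurableSpace Ω] [NormedAddCommGroup E] (f : Ω → E)
    (μ : Measure Ω) : Prop :=
  ∀ p : ℕ, MemLp f p μ

namespace MemAllLp

variable {Ω E R : Type*} [MeasurableSpace Ω] {μ : Measure Ω} [NormedAddCommGroup E]
  [NormedRing R]

theorem integrable {f : Ω → E} (hf : MemAllLp f μ) : Integrable f μ := by
  have h := hf 1
  rw [Nat.cast_one] at h
  exact memLp_one_iff_integrable.1 h

theorem add {f g : Ω → E} (hf : MemAllLp f μ) (hg : MemAllLp g μ) :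
    MemAllLp (fun ω => f ω + g ω) μ := fun p => (hf p).add (hg p)

theorem sub {f g : Ω → E} (hf : MemAllLp f μ) (hg : MemAllLp g μ) :
    MemAllLp (fun ω => f ω - g ω) μ := fun p => (hf p).sub (hg p)

theorem const [IsFiniteMeasure μ] (c : E) : MemAllLp (fun _ : Ω => c) μ :=
  fun _ => memLp_const c

theorem norm {f : Ω → E} (hf : MemAllLp f μ) : MemAllLp (fun ω => ‖f ω‖) μ :=
  fun p => (hf p).norm

theorem finset_sum {ι : Type*} (S : Finset ι) {f : ι → Ω → E} (hf : ∀ i ∈ S, MemAllLp (f i) μ) :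
    MemAllLp (fun ω => ∑ i ∈ S, f i ω) μ := fun p => memLp_finsetSum _ fun i hi => hf i hi p

theorem mul {f g : Ω → R} (hf : MemAllLp f μ) (hg : MemAllLp g μ) :
    MemAllLp (fun ω => f ω * g ω) μ := fun p => by
  have : ENNReal.HolderTriple ((2 * p : ℕ) : ℝ≥0∞) ((2 * p : ℕ) : ℝ≥0∞) (p : ℝ≥0∞) := by
    constructor
    push_cast
    rw [ENNReal.mul_inv (by simp) (by simp), ← add_mul, ENNReal.inv_two_add_inv_two, one_mul]
  exact (hg (2 * p)).mul' (hf (2 * p))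

theorem pow [IsFiniteMeasure μ] {f : Ω → R} (hf : MemAllLp f μ) (n : ℕ) :
    MemAllLp (fun ω => f ω ^ n) μ := by
  induction n with
  | zero => simpa using const (1 : R)
  | succ n ih => simpa only [pow_succ] using ih.mul hf

theorem ofReal {f : Ω → ℝ} (hf : MemAllLp f μ) : MemAllLp (fun ω => (f ω : ℂ)) μ :=
  fun p => (hf p).ofReal

theorem conj_comp {f : Ω → ℂ} (hf : MemAllLp f μ) : MemAllLp (fun ω => conj (f ω)) μ :=
  fun p => (hf p).star

theorem mixedPow [IsFiniteMeasure μ] {f : Ω → ℂ} (hf : MemAllLp f μ) (p q : ℕ) :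
    MemAllLp (fun ω => mixedPow p q (f ω)) μ := (hf.pow p).mul (hf.conj_comp.pow q)

theorem one_add_norm_pow [IsFiniteMeasure μ] {f : Ω → E} (hf : MemAllLp f μ) (m : ℕ) :
    MemAllLp (fun ω => (1 + ‖f ω‖) ^ m) μ := ((const 1).add hf.norm).pow m

end MemAllLp

/-! ### Linear combinations with small coefficients -/

/-- The linear combination `∑ r ∈ S, c r * s r` of real random variables. -/
noncomputable def linearComb {Ω : Type u} (s : ℕ → Ω → ℝ) (c : ℕ → ℂ) (S : Finset ℕ) (ω : Ω) : ℂ :=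
  ∑ r ∈ S, c r * (s r ω : ℂ)

/-- The coefficients `c r`, `r ∈ S`, are at most `δ` in modulus, and `#S * δ ^ 2 ≤ 1`. -/
structure SmallCoeffs (c : ℕ → ℂ) (δ : ℝ) (S : Finset ℕ) : Prop where
  nonneg : 0 ≤ δ
  le_one : δ ≤ 1
  norm_le : ∀ r ∈ S, ‖c r‖ ≤ δ
  card_mul_le : S.card * δ ^ 2 ≤ 1

theorem SmallCoeffs.mono {c : ℕ → ℂ} {δ : ℝ} {S T : Finset ℕ} (h : SmallCoeffs c δ S)
    (hT : T ⊆ S) : SmallCoeffs c δ T where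
  nonneg := h.nonneg
  le_one := h.le_one
  norm_le r hr := h.norm_le r (hT hr)
  card_mul_le := by
    refine le_trans ?_ h.card_mul_le
    have : (T.card : ℝ) ≤ S.card := by exact_mod_cast Finset.card_le_card hT
    gcongr

/-- The bookkeeping of all error sums: the coefficient supplies one δ and the term another, and the
number of terms times δ² is at most 1. A further factor of δ in the terms survives the summation. -/
theorem SmallCoeffs.sum_norm_mul_le {c : ℕ → ℂ} {δ : ℝ} {S : Finset ℕ} (h : SmallCoeffs c δ S)
    {f : ℕ → ℂ} {x : ℝ} (hx : 0 ≤ x) (hf : ∀ r ∈ S, ‖f r‖ ≤ δ * x) :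
    ‖∑ r ∈ S, c r * f r‖ ≤ x := by
  calc _ ≤ ∑ r ∈ S, δ ^ 2 * x := by
        refine norm_sum_le_of_le _ fun r hr => ?_
        rw [norm_mul]
        calc _ ≤ δ * (δ * x) := by
              gcongr
              · exact h.nonneg
              · exact h.norm_le r hr
              · exact hf r hr
          _ = _ := by ring
    _ = S.card * δ ^ 2 * x := by rw [Finset.sum_const, nsmul_eq_mul]; ring
    _ ≤ 1 * x := by gcongr; exact h.card_mul_le
    _ = x := one_mul x

theorem linearComb_eq_erase_add {Ω : Type u} (s : ℕ → Ω → ℝ) (c : ℕ → ℂ) {S : Finset ℕ} {r : ℕ} (hr : r ∈ S)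
    (ω : Ω) : linearComb s c S ω = linearComb s c (S.erase r) ω + c r * s r ω :=
  (Finset.sum_erase_add S _ hr).symm

/-! ### Central limit theorem in mixed moments -/

namespace IsInputSequence

variable {Ω : Type u} [MeasurableSpace Ω] {μ : Measure Ω} {s : ℕ → Ω → ℝ}

theorem memAllLp (hs : IsInputSequence s μ) (r : ℕ) : MemAllLp (s r) μ := hs.memLp r

theorem indepFun_linearComb (hs : IsInputSequence s μ) (c : ℕ → ℂ) {S : Finset ℕ} {r : ℕ}
    (hr : r ∉ S) : IndepFun (s r) (linearComb s c S) μ := by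
  have h := hs.indep.indepFun_finset {r} S (by simpa using hr) hs.measurable
  have hφ : Measurable fun x : ({r} : Finset ℕ) → ℝ => x ⟨r, Finset.mem_singleton_self r⟩ :=
    measurable_pi_apply _
  have h2 := h.comp
    (ψ := fun x : S → ℝ => ∑ i : S, c i * (x i : ℂ)) hφ (by fun_prop)
  convert! h2 using 1
  funext ω
  simp only [linearComb, Function.comp_apply]
  exact (Finset.sum_coe_sort S fun i => c i * (s i ω : ℂ)).symm

variable [IsProbabilityMeasure μ]

theorem memAllLp_linearComb (hs : IsInputSequence s μ) (c : ℕ → ℂ) (S : Finset ℕ) :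
    MemAllLp (linearComb s c S) μ :=
  MemAllLp.finset_sum S fun r _ => (MemAllLp.const (c r)).mul (hs.memAllLp r).ofReal

theorem exists_weight_bound (hs : IsInputSequence s μ) (m : ℕ) :
    ∃ K : ℝ, 0 ≤ K ∧ ∀ r, ∫ ω, (1 + ‖s r ω‖) ^ m ∂μ ≤ K := by
  obtain ⟨M, hM⟩ := hs.bounded m
  have hM0 : 0 ≤ M := le_trans (integral_nonneg fun ω => by positivity) (hM 0)
  -- Convexity of x^m gives (1 + x)^m ≤ 2^(m-1) (1 + x^m).
  refine ⟨2 ^ (m - 1) * (1 + M), by positivity, fun r => ?_⟩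
  have hi : Integrable (fun ω => ‖s r ω‖ ^ m) μ := ((hs.memAllLp r).norm.pow m).integrable
  calc _ ≤ ∫ ω, 2 ^ (m - 1) * (1 + ‖s r ω‖ ^ m) ∂μ := by
        refine integral_mono ((hs.memAllLp r).one_add_norm_pow m).integrable
          (((integrable_const 1).add hi).const_mul _) fun ω => ?_
        simpa using add_pow_le zero_le_one (norm_nonneg (s r ω)) m
    _ = 2 ^ (m - 1) * (1 + ∫ ω, ‖s r ω‖ ^ m ∂μ) := by
        rw [integral_const_mul, integral_add (integrable_const 1) hi]
        simp
    _ ≤ _ := by gcongr; exact hM r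

/-- Every Taylor remainder is dominated by a weight in `s r` times a weight in the sum over the
other indices. Independence factorises the integral of this product. -/
theorem norm_integral_le_of_weights (hs : IsInputSequence s μ) {c : ℕ → ℂ} {S : Finset ℕ} {r : ℕ}
    (hr : r ∉ S) {a b : ℕ} {C K B : ℝ} (hC : 0 ≤ C) (hK : ∫ ω, (1 + ‖s r ω‖) ^ a ∂μ ≤ K)
    (hB : ∫ ω, (1 + ‖linearComb s c S ω‖) ^ b ∂μ ≤ B) {G : Ω → ℂ}
    (hG : ∀ ω, ‖G ω‖ ≤ C * ((1 + ‖s r ω‖) ^ a * (1 + ‖linearComb s c S ω‖) ^ b)) :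
    ‖∫ ω, G ω ∂μ‖ ≤ C * (K * B) := by
  have h1 := (hs.memAllLp r).one_add_norm_pow a
  have h2 := (hs.memAllLp_linearComb c S).one_add_norm_pow b
  have hind : IndepFun (fun ω => (1 + ‖s r ω‖) ^ a)
      (fun ω => (1 + ‖linearComb s c S ω‖) ^ b) μ :=
    (hs.indepFun_linearComb c hr).comp (φ := fun x : ℝ => (1 + ‖x‖) ^ a)
      (ψ := fun x : ℂ => (1 + ‖x‖) ^ b) (by fun_prop) (by fun_prop)
  calc _ ≤ ∫ ω, C * ((1 + ‖s r ω‖) ^ a * (1 + ‖linearComb s c S ω‖) ^ b) ∂μ :=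
        norm_integral_le_of_norm_le ((h1.mul h2).integrable.const_mul C) (ae_of_all _ hG)
    _ = C * ((∫ ω, (1 + ‖s r ω‖) ^ a ∂μ) * ∫ ω, (1 + ‖linearComb s c S ω‖) ^ b ∂μ) := by
        rw [integral_const_mul, hind.integral_fun_mul_eq_mul_integral
          h1.integrable.aestronglyMeasurable h2.integrable.aestronglyMeasurable]
    _ ≤ _ := by
        gcongr
        exact le_trans (integral_nonneg fun ω => by positivity) hK

theorem integral_mul_mixedPow (hs : IsInputSequence s μ) (g : ℝ → ℝ) (hg : Measurable g)
    (hgs : ∀ r, MemAllLp (fun ω => g (s r ω)) μ) {c : ℕ → ℂ}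
    {S : Finset ℕ} {r : ℕ} (hr : r ∉ S) (p q : ℕ) :
    ∫ ω, (g (s r ω) : ℂ) * mixedPow p q (linearComb s c S ω) ∂μ =
      ((∫ ω, g (s r ω) ∂μ : ℝ) : ℂ) * ∫ ω, mixedPow p q (linearComb s c S ω) ∂μ := by
  have hind : IndepFun (fun ω => (g (s r ω) : ℂ))
      (fun ω => mixedPow p q (linearComb s c S ω)) μ :=
    (hs.indepFun_linearComb c hr).comp (φ := fun x : ℝ => (g x : ℂ))
      (ψ := mixedPow p q) (by fun_prop) (continuous_mixedPow p q).measurable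
  rw [hind.integral_fun_mul_eq_mul_integral (hgs r).ofReal.integrable.aestronglyMeasurable
    ((hs.memAllLp_linearComb c S).mixedPow p q).integrable.aestronglyMeasurable,
    integral_complex_ofReal]

theorem integral_self_mul_mixedPow (hs : IsInputSequence s μ) {c : ℕ → ℂ}
    {S : Finset ℕ} {r : ℕ} (hr : r ∉ S) (p q : ℕ) :
    ∫ ω, (s r ω : ℂ) * mixedPow p q (linearComb s c S ω) ∂μ = 0 := by
  rw [hs.integral_mul_mixedPow (fun x => x) measurable_id (fun r => hs.memAllLp r) hr, hs.mean]
  simp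

theorem integral_sq_mul_mixedPow (hs : IsInputSequence s μ) {c : ℕ → ℂ}
    {S : Finset ℕ} {r : ℕ} (hr : r ∉ S) (p q : ℕ) :
    ∫ ω, (s r ω : ℂ) ^ 2 * mixedPow p q (linearComb s c S ω) ∂μ =
      ∫ ω, mixedPow p q (linearComb s c S ω) ∂μ := by
  have h := hs.integral_mul_mixedPow (c := c) (fun x => x ^ 2) (by fun_prop)
    (fun r => (hs.memAllLp r).pow 2) hr p q
  have hv : ∫ ω, s r ω ^ 2 ∂μ = 1 := by
    have := hs.variance r
    rwa [variance_of_integral_eq_zero (hs.measurable r).aemeasurable (hs.mean r)] at this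
  rw [hv] at h
  simpa using h

theorem integral_mixedPow_succ (hs : IsInputSequence s μ) (c : ℕ → ℂ) (S : Finset ℕ) (p q : ℕ) :
    ∫ ω, mixedPow (p + 1) q (linearComb s c S ω) ∂μ =
      ∑ r ∈ S, c r * ∫ ω, (s r ω : ℂ) * mixedPow p q (linearComb s c S ω) ∂μ := by
  have hX := hs.memAllLp_linearComb c S
  simp_rw [← integral_const_mul]
  rw [← integral_finsetSum S fun r _ =>
    ((hs.memAllLp r).ofReal.mul (hX.mixedPow p q)).integrable.const_mul _]
  refine integral_congr_ae (ae_of_all _ fun ω => ?_)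
  simp only [mixedPow_succ_left]
  rw [← Finset.sum_congr rfl fun r _ => mul_assoc (c r) (s r ω : ℂ) _, ← Finset.sum_mul]
  rfl

/-- Separates the variables in the Taylor bounds, so that independence can be applied. -/
theorem one_add_add_pow_le {x y z : ℝ} (hx : 0 ≤ x) (hy : 0 ≤ y) (hz : z ≤ x) (hz0 : 0 ≤ z)
    (m : ℕ) : (1 + y + z) ^ m ≤ (1 + x) ^ m * (1 + y) ^ m := by
  rw [← mul_pow]
  gcongr
  nlinarith [mul_nonneg hx hy]

theorem norm_coeff_mul_le {c : ℂ} (hc : ‖c‖ ≤ 1) (x : ℝ) : ‖c * x‖ ≤ ‖x‖ := by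
  rw [norm_mul, Complex.norm_real]
  exact mul_le_of_le_one_left (norm_nonneg _) hc

/-- Subtracting the monomial in the sum without r changes nothing, as `s r` is centred and
independent of it. The first order Taylor bound then gains the factor ‖c r‖. The weight exponent has
the extra 2 because `s r` occurs once outside and once in the increment. -/
theorem norm_integral_self_mul_mixedPow_le (hs : IsInputSequence s μ) {c : ℕ → ℂ} {S : Finset ℕ}
    {r : ℕ} (hr : r ∈ S) (hc : ‖c r‖ ≤ 1) (p q : ℕ) {K B : ℝ}
    (hK : ∫ ω, (1 + ‖s r ω‖) ^ (p + q - 1 + 2) ∂μ ≤ K)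
    (hB : ∫ ω, (1 + ‖linearComb s c (S.erase r) ω‖) ^ (p + q - 1) ∂μ ≤ B) :
    ‖∫ ω, (s r ω : ℂ) * mixedPow p q (linearComb s c S ω) ∂μ‖ ≤
      (p + q : ℕ) * ‖c r‖ * (K * B) := by
  have hr' : r ∉ S.erase r := Finset.notMem_erase r S
  have hsr := (hs.memAllLp r).ofReal
  have e : ∫ ω, (s r ω : ℂ) * mixedPow p q (linearComb s c S ω) ∂μ =
      ∫ ω, (s r ω : ℂ) * (mixedPow p q (linearComb s c S ω) -
        mixedPow p q (linearComb s c (S.erase r) ω)) ∂μ := by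
    simp_rw [mul_sub]
    rw [integral_sub (hsr.mul ((hs.memAllLp_linearComb c S).mixedPow p q)).integrable
      (hsr.mul ((hs.memAllLp_linearComb c _).mixedPow p q)).integrable,
      hs.integral_self_mul_mixedPow hr', sub_zero]
  rw [e]
  refine hs.norm_integral_le_of_weights hr' (by positivity) hK hB fun ω => ?_
  rw [linearComb_eq_erase_add s c hr, norm_mul, Complex.norm_real]
  set Y := linearComb s c (S.erase r) ω
  have h1 := norm_mixedPow_add_sub_le p q Y (c r * s r ω)
  have h2 := one_add_add_pow_le (norm_nonneg (s r ω)) (norm_nonneg Y)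
    (norm_coeff_mul_le hc (s r ω)) (norm_nonneg _) (p + q - 1)
  calc _ ≤ ‖s r ω‖ * ((p + q : ℕ) * ‖c r * s r ω‖ *
        ((1 + ‖s r ω‖) ^ (p + q - 1) * (1 + ‖Y‖) ^ (p + q - 1))) := by gcongr; exact h1.trans (by gcongr)
    _ = (p + q : ℕ) * ‖c r‖ * (‖s r ω‖ ^ 2 *
        ((1 + ‖s r ω‖) ^ (p + q - 1) * (1 + ‖Y‖) ^ (p + q - 1))) := by
        rw [norm_mul, Complex.norm_real]; ring
    _ ≤ (p + q : ℕ) * ‖c r‖ * ((1 + ‖s r ω‖) ^ 2 *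
        ((1 + ‖s r ω‖) ^ (p + q - 1) * (1 + ‖Y‖) ^ (p + q - 1))) := by gcongr; linarith
    _ = _ := by ring

/-- Induction in steps of two: the absolute moment of order 2p + 2 is the mixed moment (p + 1, p +
1). Extracting one factor leaves terms of size O(δ), controlled by the weight of order 2p. -/
theorem exists_even_weight_bound (hs : IsInputSequence s μ) (p : ℕ) :
    ∃ B : ℝ, 0 ≤ B ∧ ∀ (c : ℕ → ℂ) (δ : ℝ) (S : Finset ℕ), SmallCoeffs c δ S →
      ∫ ω, (1 + ‖linearComb s c S ω‖) ^ (2 * p) ∂μ ≤ B := by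
  induction p with
  | zero => exact ⟨1, zero_le_one, fun c δ S _ => by simp⟩
  | succ p ih =>
    obtain ⟨B, hB0, hB⟩ := ih
    obtain ⟨K, hK0, hK⟩ := hs.exists_weight_bound (2 * p + 2)
    set D : ℝ := (p + (p + 1) : ℕ) * (K * B) with hD
    have hD0 : 0 ≤ D := by positivity
    refine ⟨2 ^ (2 * (p + 1) - 1) * (1 + D), by positivity, fun c δ S h => ?_⟩
    have hX := hs.memAllLp_linearComb c S
    have hi : Integrable (fun ω => ‖linearComb s c S ω‖ ^ (2 * (p + 1))) μ :=
      (hX.norm.pow _).integrable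
    have key : ∫ ω, ‖linearComb s c S ω‖ ^ (2 * (p + 1)) ∂μ ≤ D := by
      have e : ‖∫ ω, mixedPow (p + 1) (p + 1) (linearComb s c S ω) ∂μ‖ =
          ∫ ω, ‖linearComb s c S ω‖ ^ (2 * (p + 1)) ∂μ := by
        simp_rw [mixedPow_self]
        rw [integral_complex_ofReal, Complex.norm_real, Real.norm_of_nonneg]
        exact integral_nonneg fun ω => by positivity
      rw [← e, hs.integral_mixedPow_succ]
      refine h.sum_norm_mul_le hD0 fun r hr => ?_
      have hpq : p + (p + 1) - 1 = 2 * p := by omega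
      refine (hs.norm_integral_self_mul_mixedPow_le hr ((h.norm_le r hr).trans h.le_one) p (p + 1)
        (K := K) (B := B) (by rw [hpq]; exact hK r)
        (by rw [hpq]; exact hB c δ _ (h.mono (Finset.erase_subset r S)))).trans ?_
      calc _ = ‖c r‖ * D := by rw [hD]; ring
        _ ≤ _ := by gcongr; exact h.norm_le r hr
    calc _ ≤ ∫ ω, 2 ^ (2 * (p + 1) - 1) * (1 + ‖linearComb s c S ω‖ ^ (2 * (p + 1))) ∂μ := by
          refine integral_mono (hX.one_add_norm_pow _).integrable
            (((integrable_const 1).add hi).const_mul _) fun ω => ?_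
          simpa using add_pow_le zero_le_one (norm_nonneg (linearComb s c S ω)) (2 * (p + 1))
      _ = 2 ^ (2 * (p + 1) - 1) * (1 + ∫ ω, ‖linearComb s c S ω‖ ^ (2 * (p + 1)) ∂μ) := by
          rw [integral_const_mul, integral_add (integrable_const 1) hi]
          simp
      _ ≤ _ := by gcongr

theorem exists_linearComb_weight_bound (hs : IsInputSequence s μ) (m : ℕ) :
    ∃ B : ℝ, 0 ≤ B ∧ ∀ (c : ℕ → ℂ) (δ : ℝ) (S : Finset ℕ), SmallCoeffs c δ S →
      ∫ ω, (1 + ‖linearComb s c S ω‖) ^ m ∂μ ≤ B := by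
  obtain ⟨B, hB0, hB⟩ := hs.exists_even_weight_bound m
  refine ⟨B, hB0, fun c δ S h => le_trans ?_ (hB c δ S h)⟩
  have hX := hs.memAllLp_linearComb c S
  refine integral_mono (hX.one_add_norm_pow _).integrable (hX.one_add_norm_pow _).integrable
    fun ω => pow_le_pow_right₀ (by linarith [norm_nonneg (linearComb s c S ω)]) (by omega)

theorem exists_norm_moment_bound (hs : IsInputSequence s μ) (p q : ℕ) :
    ∃ B : ℝ, 0 ≤ B ∧ ∀ (c : ℕ → ℂ) (δ : ℝ) (S : Finset ℕ), SmallCoeffs c δ S →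
      ‖∫ ω, mixedPow p q (linearComb s c S ω) ∂μ‖ ≤ B := by
  obtain ⟨B, hB0, hB⟩ := hs.exists_linearComb_weight_bound (p + q)
  refine ⟨B, hB0, fun c δ S h => le_trans ?_ (hB c δ S h)⟩
  refine norm_integral_le_of_norm_le
    ((hs.memAllLp_linearComb c S).one_add_norm_pow _).integrable (ae_of_all _ fun ω => ?_)
  simpa using norm_mixedPow_le p q (linearComb s c S ω) le_rfl

/-- Removing one summand changes the mixed moments by at most a multiple of its coefficient. -/
theorem exists_norm_moment_sub_erase_le (hs : IsInputSequence s μ) (p q : ℕ) :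
    ∃ C : ℝ, 0 ≤ C ∧ ∀ (c : ℕ → ℂ) (δ : ℝ) (S : Finset ℕ), SmallCoeffs c δ S → ∀ r ∈ S,
      ‖∫ ω, mixedPow p q (linearComb s c S ω) ∂μ -
        ∫ ω, mixedPow p q (linearComb s c (S.erase r) ω) ∂μ‖ ≤ C * δ := by
  obtain ⟨B, hB0, hB⟩ := hs.exists_linearComb_weight_bound (p + q - 1)
  obtain ⟨K, hK0, hK⟩ := hs.exists_weight_bound (p + q - 1 + 1)
  refine ⟨(p + q : ℕ) * (K * B), by positivity, fun c δ S h r hr => ?_⟩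
  have hc := h.norm_le r hr
  rw [← integral_sub ((hs.memAllLp_linearComb c S).mixedPow p q).integrable
    ((hs.memAllLp_linearComb c _).mixedPow p q).integrable]
  have := hs.norm_integral_le_of_weights (Finset.notMem_erase r S)
    (C := (p + q : ℕ) * ‖c r‖) (by positivity) (hK r)
    (hB c δ _ (h.mono (Finset.erase_subset r S)))
    (G := fun ω => mixedPow p q (linearComb s c S ω) -
      mixedPow p q (linearComb s c (S.erase r) ω)) fun ω => ?_
  · refine this.trans ?_
    calc _ = (p + q : ℕ) * (K * B) * ‖c r‖ := by ring
      _ ≤ _ := by gcongr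
  · rw [linearComb_eq_erase_add s c hr]
    set Y := linearComb s c (S.erase r) ω
    have h2 := one_add_add_pow_le (norm_nonneg (s r ω)) (norm_nonneg Y)
      (norm_coeff_mul_le (hc.trans h.le_one) (s r ω)) (norm_nonneg _) (p + q - 1)
    calc _ ≤ (p + q : ℕ) * ‖c r * s r ω‖ *
          ((1 + ‖s r ω‖) ^ (p + q - 1) * (1 + ‖Y‖) ^ (p + q - 1)) :=
          (norm_mixedPow_add_sub_le p q Y (c r * s r ω)).trans (by gcongr)
      _ = (p + q : ℕ) * ‖c r‖ * (‖s r ω‖ *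
          ((1 + ‖s r ω‖) ^ (p + q - 1) * (1 + ‖Y‖) ^ (p + q - 1))) := by
          rw [norm_mul, Complex.norm_real]; ring
      _ ≤ (p + q : ℕ) * ‖c r‖ * ((1 + ‖s r ω‖) *
          ((1 + ‖s r ω‖) ^ (p + q - 1) * (1 + ‖Y‖) ^ (p + q - 1))) := by gcongr; linarith
      _ = _ := by ring

/-- As `s r` is real, both terms of the differential contribute (s r)², which has mean 1 and is
independent of the rest. -/
theorem integral_self_mul_mixedPowDiff (hs : IsInputSequence s μ) {c : ℕ → ℂ}
    {S : Finset ℕ} {r : ℕ} (hr : r ∉ S) (p q : ℕ) :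
    ∫ ω, (s r ω : ℂ) * mixedPowDiff p q (linearComb s c S ω) (c r * s r ω) ∂μ =
      p * c r * ∫ ω, mixedPow (p - 1) q (linearComb s c S ω) ∂μ +
        q * conj (c r) * ∫ ω, mixedPow p (q - 1) (linearComb s c S ω) ∂μ := by
  have hi : ∀ a b, Integrable (fun ω => (s r ω : ℂ) ^ 2 * mixedPow a b (linearComb s c S ω)) μ :=
    fun a b => (((hs.memAllLp r).ofReal.pow 2).mul
      ((hs.memAllLp_linearComb c S).mixedPow a b)).integrable
  rw [← hs.integral_sq_mul_mixedPow hr (p - 1), ← hs.integral_sq_mul_mixedPow hr p,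
    ← integral_const_mul, ← integral_const_mul,
    ← integral_add ((hi _ _).const_mul _) ((hi _ _).const_mul _)]
  refine integral_congr_ae (ae_of_all _ fun ω => ?_)
  simp only [mixedPowDiff, map_mul, Complex.conj_ofReal]
  ring

theorem memAllLp_mixedPowDiff (hs : IsInputSequence s μ) (c : ℕ → ℂ)
    (S : Finset ℕ) (r : ℕ) (p q : ℕ) :
    MemAllLp (fun ω => mixedPowDiff p q (linearComb s c S ω) (c r * s r ω)) μ := by
  have hX := hs.memAllLp_linearComb c S
  have hz := (MemAllLp.const (c r)).mul (hs.memAllLp r).ofReal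
  exact (((MemAllLp.const _).mul hz).mul (hX.mixedPow _ _)).add
    (((MemAllLp.const _).mul hz.conj_comp).mul (hX.mixedPow _ _))

/-- Second order expansion around the sum without r: the constant term integrates to 0 and the
linear term is computed exactly. -/
theorem exists_norm_self_moment_sub_le (hs : IsInputSequence s μ) (p q : ℕ) :
    ∃ C : ℝ, 0 ≤ C ∧ ∀ (c : ℕ → ℂ) (δ : ℝ) (S : Finset ℕ), SmallCoeffs c δ S → ∀ r ∈ S,
      ‖∫ ω, (s r ω : ℂ) * mixedPow p q (linearComb s c S ω) ∂μ -
        (p * c r * ∫ ω, mixedPow (p - 1) q (linearComb s c S ω) ∂μ +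
        q * conj (c r) * ∫ ω, mixedPow p (q - 1) (linearComb s c S ω) ∂μ)‖ ≤ C * δ ^ 2 := by
  obtain ⟨B, hB0, hB⟩ := hs.exists_linearComb_weight_bound (p + q)
  obtain ⟨K, hK0, hK⟩ := hs.exists_weight_bound (p + q + 3)
  obtain ⟨C₁, hC₁, h₁⟩ := hs.exists_norm_moment_sub_erase_le (p - 1) q
  obtain ⟨C₂, hC₂, h₂⟩ := hs.exists_norm_moment_sub_erase_le p (q - 1)
  -- The first summand bounds the Taylor remainder. The others pay for restoring the r-th summand in
  -- the lower moments, each a change of order δ multiplied by a coefficient of size at most δ.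
  refine ⟨((p + q : ℕ) : ℝ) ^ 2 * (K * B) + (p * C₁ + q * C₂), by positivity,
    fun c δ S h r hr => ?_⟩
  have hc := h.norm_le r hr
  have hδ := h.nonneg
  have hr' := Finset.notMem_erase r S
  specialize h₁ c δ S h r hr
  specialize h₂ c δ S h r hr
  have hsr := (hs.memAllLp r).ofReal
  have i1 := hsr.mul ((hs.memAllLp_linearComb c S).mixedPow p q)
  have i2 := hsr.mul ((hs.memAllLp_linearComb c (S.erase r)).mixedPow p q)
  have i3 := hsr.mul (hs.memAllLp_mixedPowDiff c (S.erase r) r p q)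
  have hT : ‖∫ ω, ((s r ω : ℂ) * mixedPow p q (linearComb s c S ω) -
      (s r ω : ℂ) * mixedPow p q (linearComb s c (S.erase r) ω) -
      (s r ω : ℂ) * mixedPowDiff p q (linearComb s c (S.erase r) ω) (c r * s r ω)) ∂μ‖ ≤
      (((p + q : ℕ) : ℝ) ^ 2 * ‖c r‖ ^ 2) * (K * B) := by
    refine hs.norm_integral_le_of_weights hr' (by positivity) (hK r)
      (hB c δ _ (h.mono (Finset.erase_subset r S))) fun ω => ?_
    rw [← mul_sub, ← mul_sub, linearComb_eq_erase_add s c hr, norm_mul, Complex.norm_real]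
    set Y := linearComb s c (S.erase r) ω
    have h2 := one_add_add_pow_le (norm_nonneg (s r ω)) (norm_nonneg Y)
      (norm_coeff_mul_le (hc.trans h.le_one) (s r ω)) (norm_nonneg _) (p + q)
    calc _ ≤ ‖s r ω‖ * (((p + q : ℕ) : ℝ) ^ 2 * ‖c r * s r ω‖ ^ 2 *
          ((1 + ‖s r ω‖) ^ (p + q) * (1 + ‖Y‖) ^ (p + q))) := by
          gcongr
          exact (norm_mixedPow_add_sub_sub_le p q Y (c r * s r ω)).trans (by gcongr)
      _ = ((p + q : ℕ) : ℝ) ^ 2 * ‖c r‖ ^ 2 * (‖s r ω‖ ^ 3 *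
          ((1 + ‖s r ω‖) ^ (p + q) * (1 + ‖Y‖) ^ (p + q))) := by
          rw [norm_mul, Complex.norm_real]; ring
      _ ≤ ((p + q : ℕ) : ℝ) ^ 2 * ‖c r‖ ^ 2 * ((1 + ‖s r ω‖) ^ 3 *
          ((1 + ‖s r ω‖) ^ (p + q) * (1 + ‖Y‖) ^ (p + q))) := by gcongr; linarith
      _ = _ := by ring
  rw [integral_sub (i1.sub i2).integrable i3.integrable, integral_sub i1.integrable i2.integrable,
    hs.integral_self_mul_mixedPow hr', hs.integral_self_mul_mixedPowDiff hr', sub_zero] at hT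
  set E := ∫ ω, (s r ω : ℂ) * mixedPow p q (linearComb s c S ω) ∂μ
  set X₁ := ∫ ω, mixedPow (p - 1) q (linearComb s c S ω) ∂μ
  set X₂ := ∫ ω, mixedPow p (q - 1) (linearComb s c S ω) ∂μ
  set Y₁ := ∫ ω, mixedPow (p - 1) q (linearComb s c (S.erase r) ω) ∂μ
  set Y₂ := ∫ ω, mixedPow p (q - 1) (linearComb s c (S.erase r) ω) ∂μ
  have e : E - (p * c r * X₁ + q * conj (c r) * X₂) =
      (E - (p * c r * Y₁ + q * conj (c r) * Y₂)) -
        (p * c r * (X₁ - Y₁) + q * conj (c r) * (X₂ - Y₂)) := by ring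
  have hc' : ‖conj (c r)‖ ≤ δ := by rwa [RCLike.norm_conj]
  have hlin : ‖(p : ℂ) * c r * (X₁ - Y₁) + q * conj (c r) * (X₂ - Y₂)‖ ≤
      p * δ * (C₁ * δ) + q * δ * (C₂ * δ) := by
    refine norm_add_le_of_le ?_ ?_ <;> rw [norm_mul, norm_mul, Complex.norm_natCast] <;> gcongr
  rw [e]
  calc _ ≤ _ := norm_sub_le_of_le hT hlin
    _ ≤ ((p + q : ℕ) : ℝ) ^ 2 * δ ^ 2 * (K * B) + (p * δ * (C₁ * δ) + q * δ * (C₂ * δ)) := by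
        gcongr
    _ = _ := by ring

/-- Approximate Gaussian recursion for the mixed moments. -/
theorem exists_norm_moment_succ_sub_le (hs : IsInputSequence s μ) (p q : ℕ) :
    ∃ C : ℝ, 0 ≤ C ∧ ∀ (c : ℕ → ℂ) (δ : ℝ) (S : Finset ℕ), SmallCoeffs c δ S →
      ∑ r ∈ S, ‖c r‖ ^ 2 = 1 →
      ‖∫ ω, mixedPow (p + 1) q (linearComb s c S ω) ∂μ -
        q * ∫ ω, mixedPow p (q - 1) (linearComb s c S ω) ∂μ‖ ≤
          C * (‖∑ r ∈ S, c r ^ 2‖ + δ) := by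
  obtain ⟨C, hC0, hC⟩ := hs.exists_norm_self_moment_sub_le p q
  obtain ⟨B, hB0, hB⟩ := hs.exists_norm_moment_bound (p - 1) q
  refine ⟨C + p * B, by positivity, fun c δ S h hsum => ?_⟩
  have hδ := h.nonneg
  specialize hC c δ S h
  specialize hB c δ S h
  rw [hs.integral_mixedPow_succ]
  set E := fun r => ∫ ω, (s r ω : ℂ) * mixedPow p q (linearComb s c S ω) ∂μ
  set X₁ := ∫ ω, mixedPow (p - 1) q (linearComb s c S ω) ∂μ
  set X₂ := ∫ ω, mixedPow p (q - 1) (linearComb s c S ω) ∂μ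
  have hsum' : ∑ r ∈ S, c r * conj (c r) = 1 := by
    simp_rw [Complex.mul_conj, Complex.normSq_eq_norm_sq]
    exact_mod_cast hsum
  -- The lower moments do not depend on r and leave the sum: X₂ meets ∑ |c r|² = 1, X₁ meets the
  -- defect ∑ (c r)².
  have e : ∑ r ∈ S, c r * E r - q * X₂ =
      ∑ r ∈ S, c r * (E r - (p * c r * X₁ + q * conj (c r) * X₂)) +
        (∑ r ∈ S, c r ^ 2) * (p * X₁) := by
    have : ∑ r ∈ S, c r * (E r - (p * c r * X₁ + q * conj (c r) * X₂)) =
        ∑ r ∈ S, c r * E r - ((∑ r ∈ S, c r ^ 2) * (p * X₁) +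
          (∑ r ∈ S, c r * conj (c r)) * (q * X₂)) := by
      rw [Finset.sum_mul, Finset.sum_mul, ← Finset.sum_add_distrib, ← Finset.sum_sub_distrib]
      exact Finset.sum_congr rfl fun r _ => by ring
    rw [this, hsum']
    ring
  rw [e]
  have h1 := h.sum_norm_mul_le (f := fun r => E r - (p * c r * X₁ + q * conj (c r) * X₂))
    (x := C * δ) (by positivity) fun r hr => (hC r hr).trans_eq (by ring)
  have h2 : ‖(∑ r ∈ S, c r ^ 2) * (p * X₁)‖ ≤ ‖∑ r ∈ S, c r ^ 2‖ * (p * B) := by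
    rw [norm_mul, norm_mul, Complex.norm_natCast]
    gcongr
  refine (norm_add_le_of_le h1 h2).trans ?_
  have h3 : 0 ≤ C * ‖∑ r ∈ S, c r ^ 2‖ := by positivity
  have h4 : 0 ≤ (p * B) * δ := by positivity
  nlinarith

/-- Quantitative central limit theorem in mixed moments: the limits are the moments of a standard
complex Gaussian variable. -/
theorem exists_norm_moment_sub_factorial_le (hs : IsInputSequence s μ) (p q : ℕ) :
    ∃ C : ℝ, 0 ≤ C ∧ ∀ (c : ℕ → ℂ) (δ : ℝ) (S : Finset ℕ), SmallCoeffs c δ S →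
      ∑ r ∈ S, ‖c r‖ ^ 2 = 1 →
      ‖∫ ω, mixedPow p q (linearComb s c S ω) ∂μ - (if p = q then (p.factorial : ℂ) else 0)‖ ≤
          C * (‖∑ r ∈ S, c r ^ 2‖ + δ) := by
  -- For q = 0 the main term of the recursion carries the factor q and disappears.
  have hzero : ∀ p, ∃ C : ℝ, 0 ≤ C ∧ ∀ (c : ℕ → ℂ) (δ : ℝ) (S : Finset ℕ), SmallCoeffs c δ S →
      ∑ r ∈ S, ‖c r‖ ^ 2 = 1 →
      ‖∫ ω, mixedPow (p + 1) 0 (linearComb s c S ω) ∂μ‖ ≤ C * (‖∑ r ∈ S, c r ^ 2‖ + δ) := by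
    intro p
    simpa using hs.exists_norm_moment_succ_sub_le p 0
  induction p generalizing q with
  | zero =>
    cases q with
    | zero =>
      exact ⟨0, le_rfl, fun c δ S h _ => by simp⟩
    | succ q =>
      obtain ⟨C, hC0, hC⟩ := hzero q
      refine ⟨C, hC0, fun c δ S h hsum => ?_⟩
      have : ∫ ω, mixedPow 0 (q + 1) (linearComb s c S ω) ∂μ =
          conj (∫ ω, mixedPow (q + 1) 0 (linearComb s c S ω) ∂μ) := by
        rw [← integral_conj]
        simp_rw [conj_mixedPow]
      rw [this, if_neg (by omega), sub_zero, RCLike.norm_conj]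
      exact hC c δ S h hsum
  | succ p ih =>
    cases q with
    | zero => simpa using hzero p
    | succ q =>
      obtain ⟨C₁, hC₁, h₁⟩ := hs.exists_norm_moment_succ_sub_le p (q + 1)
      obtain ⟨C₂, hC₂, h₂⟩ := ih q
      refine ⟨C₁ + (q + 1 : ℕ) * C₂, by positivity, fun c δ S h hsum => ?_⟩
      specialize h₁ c δ S h hsum
      specialize h₂ c δ S h hsum
      rw [Nat.add_sub_cancel] at h₁
      set X := ∫ ω, mixedPow (p + 1) (q + 1) (linearComb s c S ω) ∂μ
      set Y := ∫ ω, mixedPow p q (linearComb s c S ω) ∂μ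
      have hg : (if p + 1 = q + 1 then ((p + 1).factorial : ℂ) else 0) =
          (q + 1 : ℕ) * (if p = q then (p.factorial : ℂ) else 0) := by
        by_cases hpq : p = q
        · subst hpq; simp [Nat.factorial_succ]
        · simp [hpq]
      have e : X - (q + 1 : ℕ) * (if p = q then (p.factorial : ℂ) else 0) =
          (X - (q + 1 : ℕ) * Y) +
            (q + 1 : ℕ) * (Y - (if p = q then (p.factorial : ℂ) else 0)) := by ring
      rw [hg, e]
      refine (norm_add_le_of_le h₁ (r₂ := (q + 1 : ℕ) * (C₂ * (‖∑ r ∈ S, c r ^ 2‖ + δ))) ?_).trans_eq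
        (by ring)
      rw [norm_mul, Complex.norm_natCast]
      gcongr

end IsInputSequence

/-! ### Moments of the standard complex Gaussian -/

theorem mixedPow_mul (p q : ℕ) (a z : ℂ) :
    mixedPow p q (a * z) = mixedPow p q a * mixedPow p q z := by
  simp only [mixedPow, map_mul, mul_pow]; ring

/-- Rotation by the angle π/(p - q) preserves the weight and Lebesgue measure but multiplies the
monomial by -1. -/
theorem integral_mixedPow_mul_exp_of_ne {p q : ℕ} (h : p ≠ q) :
    ∫ z : ℂ, (Real.exp (-‖z‖ ^ 2) : ℂ) * mixedPow p q z = 0 := by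
  have hd : ((p : ℝ) - q) ≠ 0 := sub_ne_zero.2 (by exact_mod_cast h)
  set a : Circle := Circle.exp (Real.pi / ((p : ℝ) - q)) with ha
  have hap : mixedPow p q (a : ℂ) = -1 := by
    have hdc : ((p : ℂ) - q) ≠ 0 := sub_ne_zero.2 (by exact_mod_cast h)
    rw [mixedPow, ← Circle.coe_inv_eq_conj, ha, ← Circle.exp_neg, Circle.coe_exp, Circle.coe_exp,
      ← Complex.exp_nat_mul, ← Complex.exp_nat_mul, ← Complex.exp_add, ← Complex.exp_pi_mul_I]
    congr 1
    push_cast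
    field_simp
    ring
  have hrot := (rotation a).measurePreserving.integral_comp
    (rotation a).toHomeomorph.measurableEmbedding
    (fun z : ℂ => (Real.exp (-‖z‖ ^ 2) : ℂ) * mixedPow p q z)
  simp only [rotation_apply, mixedPow_mul, hap, norm_mul, Circle.norm_coe, one_mul] at hrot
  have h2 : ∫ z : ℂ, (Real.exp (-‖z‖ ^ 2) : ℂ) * (-1 * mixedPow p q z) =
      -∫ z : ℂ, (Real.exp (-‖z‖ ^ 2) : ℂ) * mixedPow p q z := by
    rw [← integral_neg]
    simp
  rw [h2] at hrot
  exact self_eq_neg.1 hrot.symm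

theorem integral_mixedPow_self_mul_exp (p : ℕ) :
    ∫ z : ℂ, (Real.exp (-‖z‖ ^ 2) : ℂ) * mixedPow p p z = Real.pi * p.factorial := by
  have h := Complex.integral_rpow_mul_exp_neg_rpow (p := 2) (q := (2 * p : ℕ)) one_le_two
    (by linarith [(2 * p : ℕ).cast_nonneg (α := ℝ)])
  have e : ((2 * p : ℕ) + 2 : ℝ) / 2 = p + 1 := by push_cast; ring
  rw [e, Real.Gamma_nat_eq_factorial] at h
  simp only [Real.rpow_natCast, Real.rpow_two] at h
  have h2 : (2 * Real.pi / 2 : ℝ) = Real.pi := by ring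
  rw [h2] at h
  rw [← Complex.ofReal_natCast, ← Complex.ofReal_mul, ← h, ← integral_complex_ofReal]
  refine integral_congr_ae (ae_of_all _ fun z => ?_)
  simp only [mixedPow_self]
  push_cast
  ring

/-- With variance 1/2 in each coordinate, the joint density is exp(-|z|²)/π. -/
theorem integral_gaussian_prod_eq (f : ℂ → ℂ) :
    ∫ z : ℝ × ℝ, f ((z.1 : ℂ) + (z.2 : ℂ) * Complex.I)
      ∂((gaussianReal 0 (1 / 2)).prod (gaussianReal 0 (1 / 2))) =
      (Real.pi : ℂ)⁻¹ * ∫ z : ℂ, (Real.exp (-‖z‖ ^ 2) : ℂ) * f z := by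
  have hv : (1 / 2 : NNReal) ≠ 0 := by norm_num
  have hm := measurable_gaussianPDF 0 (1 / 2)
  rw [gaussianReal_of_var_ne_zero _ hv, prod_withDensity hm hm,
    integral_withDensity_eq_integral_toReal_smul (by fun_prop)
      (ae_of_all _ fun z => ENNReal.mul_lt_top gaussianPDF_lt_top gaussianPDF_lt_top),
    ← Measure.volume_eq_prod, ← Complex.volume_preserving_equiv_real_prod.integral_comp
      Complex.measurableEquivRealProd.measurableEmbedding, ← integral_const_mul]
  refine integral_congr_ae (ae_of_all _ fun z => ?_)
  have hz : (‖z‖ ^ 2 : ℝ) = z.re ^ 2 + z.im ^ 2 := by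
    rw [← Complex.normSq_eq_norm_sq, Complex.normSq_apply]; ring
  have hpdf : gaussianPDFReal 0 (1 / 2) z.re * gaussianPDFReal 0 (1 / 2) z.im =
      Real.pi⁻¹ * Real.exp (-‖z‖ ^ 2) := by
    simp only [gaussianPDFReal]
    rw [mul_mul_mul_comm, ← Real.exp_add, ← mul_inv, Real.mul_self_sqrt (by positivity), hz]
    push_cast
    congr 2 <;> ring
  simp only [Complex.measurableEquivRealProd_apply, Complex.re_add_im, ENNReal.toReal_mul,
    toReal_gaussianPDF, hpdf, Complex.real_smul]
  push_cast
  ring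

theorem complexGaussianMoment_eq (p q : ℕ) :
    complexGaussianMoment p q = if p = q then (p.factorial : ℂ) else 0 := by
  have h := integral_gaussian_prod_eq (mixedPow p q)
  rw [complexGaussianMoment]
  refine h.trans ?_
  split_ifs with hpq
  · subst hpq
    rw [integral_mixedPow_self_mul_exp, inv_mul_cancel_left₀]
    exact_mod_cast Real.pi_ne_zero
  · rw [integral_mixedPow_mul_exp_of_ne hpq, mul_zero]

/-! ### Words in commuting variables -/

theorem map_starMonomial {A B : Type*} [Ring A] [StarRing A] [Ring B] [StarRing B]
    (f : A →+* B) (hf : ∀ a, f (star a) = star (f a)) {k : ℕ} (x : Fin k → A)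
    (w : List (Fin k × Bool)) :
    f (starMonomial x w) = starMonomial (fun j => f (x j)) w := by
  rw [starMonomial, starMonomial, map_list_prod, List.map_map]
  congr 2
  funext l
  simp only [Function.comp_apply]
  split_ifs <;> simp [hf]

theorem List.prod_map_prod_bool {M : Type*} [CommMonoid M] {k : ℕ} (y : Fin k × Bool → M)
    (w : List (Fin k × Bool)) :
    (w.map y).prod =
      ∏ j : Fin k, y (j, false) ^ w.count (j, false) * y (j, true) ^ w.count (j, true) := by
  have h : (w.map y).prod = ∏ l : Fin k × Bool, y l ^ w.count l := by
    induction w with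
    | nil => simp
    | cons a w ih =>
      simp only [List.map_cons, List.prod_cons, ih, List.count_cons, pow_add,
        Finset.prod_mul_distrib, beq_iff_eq, pow_ite, pow_one, pow_zero, Finset.prod_ite_eq,
        Finset.mem_univ, if_true, mul_comm]
  rw [h, Fintype.prod_prod_type]
  simp [mul_comm]

/-- A `*`-monomial in commuting variables can be sorted. -/
theorem starMonomial_eq_prod_ofFn {A : Type*} [Ring A] [StarRing A] {k : ℕ} (x : Fin k → A)
    (h : ∀ i j, Commute (x i) (x j)) (h' : ∀ i j, Commute (x i) (star (x j)))
    (w : List (Fin k × Bool)) :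
    starMonomial x w = (List.ofFn fun j =>
      x j ^ w.count (j, false) * star (x j) ^ w.count (j, true)).prod := by
  let y : Fin k × Bool → A := fun l => if l.2 then star (x l.1) else x l.1
  have hy : ∀ a ∈ Set.range y, ∀ b ∈ Set.range y, a * b = b * a := by
    rintro _ ⟨⟨i, b⟩, rfl⟩ _ ⟨⟨j, c⟩, rfl⟩
    cases b <;> cases c <;> simp only [y, Bool.false_eq_true, if_true, if_false]
    · exact h i j
    · exact h' i j
    · exact (h' j i).symm
    · exact (h i j).star_star
  -- The letters commute pairwise, so they generate a commutative subring; the word is sorted there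
  -- and mapped back to A.
  have : IsMulCommutative (Algebra.adjoin ℤ (Set.range y)) := Algebra.isMulCommutative_adjoin ℤ hy
  let C := Algebra.adjoin ℤ (Set.range y)
  let z : Fin k × Bool → C := fun l => ⟨y l, Algebra.subset_adjoin ⟨l, rfl⟩⟩
  let f : C →* A := C.val
  open scoped IsMulCommutative in
  have key := congrArg f (List.prod_map_prod_bool z w)
  rw [map_list_prod, List.map_map, ← List.prod_ofFn, map_list_prod, List.map_ofFn] at key
  refine key.trans ?_
  congr 2

/-! ### Random scalar matrices and existence of the limit variables -/

section

variable {Ω : Type u} [MeasurableSpace Ω] (μ : Measure Ω) [IsProbabilityMeasure μ] (n : ℕ)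

/-- Evaluation of random matrices at a sample point. -/
def randomMatricesEval (ω : Ω) : randomMatrices μ n →+* Matrix (Fin n) (Fin n) ℂ :=
  (Pi.evalRingHom _ ω).comp (randomMatrices μ n).subtype.toRingHom

theorem randomMatricesEval_star (ω : Ω) (X : randomMatrices μ n) :
    randomMatricesEval μ n ω (star X) = star (randomMatricesEval μ n ω X) := rfl

theorem randomMatrices_ext {X Y : randomMatrices μ n}
    (h : ∀ ω, randomMatricesEval μ n ω X = randomMatricesEval μ n ω Y) : X = Y :=
  Subtype.ext (funext h)

theorem randomMatrixSpace_state (n : ℕ+) (X : randomMatrices μ n) :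
    (randomMatrixSpace μ n).state X =
      ((n : ℕ) : ℂ)⁻¹ * ∫ ω, (randomMatricesEval μ n ω X).trace ∂μ := rfl

/-- The random scalar matrix of a random variable with moments of all orders. -/
def randomScalar (f : Ω → ℂ) (hf : MemAllLp f μ) : randomMatrices μ n :=
  ⟨fun ω => Matrix.scalar (Fin n) (f ω), fun i j p => by
    by_cases h : i = j
    · subst h
      simpa using hf p
    · simp [Matrix.diagonal_apply_ne _ h]⟩

theorem star_scalar {n : ℕ} (z : ℂ) :
    star (Matrix.scalar (Fin n) z) = Matrix.scalar (Fin n) (conj z) := by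
  simp [Matrix.star_eq_conjTranspose, Matrix.scalar_apply, Matrix.diagonal_conjTranspose]

theorem randomMatrixSpace_state_of_scalar (n : ℕ+) (X : randomMatrices μ n) (g : Ω → ℂ)
    (h : ∀ ω, randomMatricesEval μ n ω X = Matrix.scalar (Fin n) (g ω)) :
    (randomMatrixSpace μ n).state X = ∫ ω, g ω ∂μ := by
  rw [randomMatrixSpace_state]
  simp_rw [h, Matrix.scalar_apply, Matrix.trace_diagonal]
  simp only [Finset.sum_const, Finset.card_univ, Fintype.card_fin, nsmul_eq_mul]
  rw [integral_const_mul, inv_mul_cancel_left₀]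
  exact_mod_cast n.ne_zero

end

theorem memAllLp_complexGaussian :
    MemAllLp (fun z : ℝ × ℝ => (z.1 : ℂ) + (z.2 : ℂ) * Complex.I)
      ((gaussianReal 0 (1 / 2)).prod (gaussianReal 0 (1 / 2))) := by
  have h : MemAllLp (fun x : ℝ => x) (gaussianReal 0 (1 / 2)) :=
    fun p => memLp_id_gaussianReal' _ (ENNReal.natCast_ne_top p)
  have h1 : MemAllLp (fun z : ℝ × ℝ => z.1)
      ((gaussianReal 0 (1 / 2)).prod (gaussianReal 0 (1 / 2))) :=
    fun p => (h p).comp_measurePreserving measurePreserving_fst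
  have h2 : MemAllLp (fun z : ℝ × ℝ => z.2)
      ((gaussianReal 0 (1 / 2)).prod (gaussianReal 0 (1 / 2))) :=
    fun p => (h p).comp_measurePreserving measurePreserving_snd
  exact h1.ofReal.add (h2.ofReal.mul (MemAllLp.const _))

/-- The model consists of 1 × 1 random matrices on the k-fold power of the Gaussian measure on ℝ²,
with the coordinates as variables; Fubini gives the factorisation. -/
theorem exists_independent_standardComplexGaussian (k : ℕ) :
    ∃ (B : StarProbSpace.{0}) (N : Fin k → B.carrier),
      (∀ j, IsStandardComplexGaussian B (N j)) ∧ StarIndependent B N := by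
  let G : Measure (ℝ × ℝ) := (gaussianReal 0 (1 / 2)).prod (gaussianReal 0 (1 / 2))
  let μ : Measure (Fin k → ℝ × ℝ) := Measure.pi fun _ => G
  let f : ℝ × ℝ → ℂ := fun z => (z.1 : ℂ) + (z.2 : ℂ) * Complex.I
  have hf : ∀ j : Fin k, MemAllLp (fun x : Fin k → ℝ × ℝ => f (x j)) μ := fun j p =>
    (memAllLp_complexGaussian p).comp_measurePreserving (measurePreserving_eval _ j)
  let N : Fin k → randomMatrices μ ((1 : ℕ+) : ℕ) := fun j => randomScalar μ _ _ (hf j)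
  have hN : ∀ j x, randomMatricesEval μ _ x (N j) = Matrix.scalar _ (f (x j)) := fun j x => rfl
  have hpow : ∀ j p q x, randomMatricesEval μ _ x (N j ^ p * star (N j) ^ q) =
      Matrix.scalar _ (mixedPow p q (f (x j))) := by
    intro j p q x
    rw [map_mul, map_pow, map_pow, randomMatricesEval_star, hN, star_scalar, ← map_pow, ← map_pow,
      ← map_mul]
    rfl
  have hstate : ∀ j p q, (randomMatrixSpace μ 1).state (N j ^ p * star (N j) ^ q) =
      complexGaussianMoment p q := by
    intro j p q
    refine (randomMatrixSpace_state_of_scalar μ 1 _ _ (hpow j p q)).trans ?_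
    exact integral_comp_eval (μ := fun _ : Fin k => G) (f := fun z => mixedPow p q (f z))
      (memAllLp_complexGaussian.mixedPow p q).integrable.aestronglyMeasurable
  have hcomm : ∀ i j, Commute (N i) (N j) := fun i j => by
    refine randomMatrices_ext μ _ fun x => ?_
    rw [map_mul, map_mul, hN, hN, ← map_mul, ← map_mul, mul_comm]
  have hcomm' : ∀ i j, Commute (N i) (star (N j)) := fun i j => by
    refine randomMatrices_ext μ _ fun x => ?_
    rw [map_mul, map_mul, randomMatricesEval_star, hN, hN, star_scalar, ← map_mul, ← map_mul,
      mul_comm]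
  refine ⟨randomMatrixSpace μ 1, N, fun j => ⟨fun h => ?_, ⟨(hcomm' j j).symm⟩, hstate j⟩,
    fun i j _ => hcomm i j, fun i j _ => hcomm' i j, fun p q => ?_⟩
  -- Equality of random matrices is pointwise, so one sample point with value i refutes
  -- self-adjointness.
  · have h1 : star (randomMatricesEval μ _ (fun _ => (0, 1)) (N j)) =
        randomMatricesEval μ _ (fun _ => (0, 1)) (N j) :=
      congrArg (randomMatricesEval μ _ fun _ => (0, 1)) (h : star (N j) = N j)
    rw [hN, star_scalar] at h1
    have h2 := congrFun (congrFun h1 ⟨0, (1 : ℕ+).pos⟩) ⟨0, (1 : ℕ+).pos⟩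
    have h3 : f (0, 1) = Complex.I := by simp [f]
    simp only [Matrix.scalar_apply, Matrix.diagonal_apply_eq, h3, Complex.conj_I] at h2
    exact Complex.I_ne_zero (neg_eq_self.1 h2)
  · have hprod : ∀ x, randomMatricesEval μ _ x
        (List.ofFn fun j => N j ^ p j * star (N j) ^ q j).prod =
        Matrix.scalar _ (∏ j, mixedPow (p j) (q j) (f (x j))) := by
      intro x
      rw [map_list_prod, List.map_ofFn, ← List.prod_ofFn, map_list_prod, List.map_ofFn]
      congr 2
      funext j
      exact hpow j (p j) (q j) x
    refine (randomMatrixSpace_state_of_scalar μ 1 _ _ hprod).trans ?_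
    refine (integral_fintype_prod_eq_prod (μ := fun _ : Fin k => G)
      (fun j z => mixedPow (p j) (q j) (f z))).trans ?_
    exact Finset.prod_congr rfl fun j _ => (hstate j (p j) (q j)).symm

/-- The `*`-moments of independent standard complex Gaussian variables. -/
theorem StarIndependent.state_starMonomial {B : StarProbSpace.{v}} {k : ℕ} {N : Fin k → B.carrier}
    (hN : ∀ j, IsStandardComplexGaussian B (N j)) (h : StarIndependent B N)
    (w : List (Fin k × Bool)) :
    B.state (starMonomial N w) =
      ∏ j, if w.count (j, false) = w.count (j, true)
        then ((w.count (j, false)).factorial : ℂ) else 0 := by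
  rw [starMonomial_eq_prod_ofFn, h.factorize]
  · refine Finset.prod_congr rfl fun j _ => ?_
    rw [(hN j).moments, complexGaussianMoment_eq]
  · intro i j
    by_cases hij : i = j
    · subst hij; exact Commute.refl _
    · exact h.commute i j hij
  · intro i j
    by_cases hij : i = j
    · subst hij; exact (hN i).normal.star_comm_self.symm
    · exact h.commute_star i j hij

/-! ### Simultaneous diagonalisation of skew-circulant matrices -/

/-- The `n`-th roots of `-1`. -/
noncomputable def negOneRoot (n t : ℕ) : ℂ := Complex.exp (Real.pi * Complex.I * (2 * t + 1) / n)

theorem negOneRoot_pow_self {n : ℕ} (hn : n ≠ 0) (t : ℕ) : negOneRoot n t ^ n = -1 := by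
  have hn' : (n : ℂ) ≠ 0 := by exact_mod_cast hn
  rw [negOneRoot, ← Complex.exp_nat_mul, mul_div_cancel₀ _ hn']
  have : (Real.pi : ℂ) * Complex.I * (2 * t + 1) =
      t * (2 * Real.pi * Complex.I) + Real.pi * Complex.I := by ring
  rw [this, Complex.exp_add, Complex.exp_nat_mul_two_pi_mul_I, one_mul, Complex.exp_pi_mul_I]

theorem norm_negOneRoot (n t : ℕ) : ‖negOneRoot n t‖ = 1 := by
  have : (Real.pi : ℂ) * Complex.I * (2 * t + 1) / n =
      ((Real.pi * (2 * t + 1) / n : ℝ) : ℂ) * Complex.I := by push_cast; ring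
  rw [negOneRoot, this, Complex.norm_exp_ofReal_mul_I]

theorem negOneRoot_ne_zero (n t : ℕ) : negOneRoot n t ≠ 0 := Complex.exp_ne_zero _

theorem conj_negOneRoot (n t : ℕ) : conj (negOneRoot n t) = (negOneRoot n t)⁻¹ :=
  (Complex.inv_eq_conj (norm_negOneRoot n t)).symm

theorem negOneRoot_injective (n : ℕ) : Function.Injective fun t : Fin n => negOneRoot n t := by
  intro t u h
  have hn : n ≠ 0 := fun h0 => by subst h0; exact t.elim0
  have e : ∀ t : ℕ, negOneRoot n t =
      Complex.exp (Real.pi * Complex.I / n) * Complex.exp (2 * Real.pi * Complex.I / n) ^ t := by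
    intro t
    rw [negOneRoot, ← Complex.exp_nat_mul, ← Complex.exp_add]
    congr 1
    ring
  simp only [e] at h
  exact Fin.ext ((Complex.isPrimitiveRoot_exp n hn).pow_inj t.2 u.2
    (mul_left_cancel₀ (Complex.exp_ne_zero _) h))

theorem geom_sum_eq_zero_of_pow_eq_one {z : ℂ} {n : ℕ} (hz : z ≠ 1) (h : z ^ n = 1) :
    ∑ r ∈ Finset.range n, z ^ r = 0 := by
  rw [geom_sum_eq hz, h, sub_self, zero_div]

/-- The matrix of eigenvectors of the skew-circulant matrices. -/
noncomputable def skewFourier (n : ℕ) : Matrix (Fin n) (Fin n) ℂ :=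
  Matrix.of fun i t => negOneRoot n t ^ (i : ℕ)

/-- The quotient of two n-th roots of -1 is an n-th root of unity, so off the diagonal the geometric
sum vanishes. -/
theorem skewFourier_conjTranspose_mul (n : ℕ) :
    (skewFourier n).conjTranspose * skewFourier n = (n : ℂ) • (1 : Matrix (Fin n) (Fin n) ℂ) := by
  ext t u
  have hn : n ≠ 0 := fun h0 => by subst h0; exact t.elim0
  have e : ∑ i : Fin n, (skewFourier n).conjTranspose t i * skewFourier n i u =
      ∑ r ∈ Finset.range n, ((negOneRoot n t)⁻¹ * negOneRoot n u) ^ r := by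
    rw [Finset.sum_range]
    refine Finset.sum_congr rfl fun i _ => ?_
    simp [skewFourier, Matrix.conjTranspose_apply, conj_negOneRoot, mul_pow]
  rw [Matrix.mul_apply, e]
  by_cases h : t = u
  · subst h
    simp [inv_mul_cancel₀ (negOneRoot_ne_zero n t)]
  · rw [geom_sum_eq_zero_of_pow_eq_one]
    · simp [Matrix.one_apply_ne h]
    · intro h1
      refine h (negOneRoot_injective n ?_)
      exact (inv_mul_eq_one₀ (negOneRoot_ne_zero n t)).1 h1
    · rw [mul_pow, inv_pow, negOneRoot_pow_self hn, negOneRoot_pow_self hn]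
      norm_num

theorem skewFourier_mul_conjTranspose (n : ℕ) :
    skewFourier n * (skewFourier n).conjTranspose = (n : ℂ) • (1 : Matrix (Fin n) (Fin n) ℂ) := by
  rcases Nat.eq_zero_or_pos n with rfl | hn
  · ext i; exact i.elim0
  have hn' : (n : ℂ) ≠ 0 := by exact_mod_cast hn.ne'
  have h : ((n : ℂ)⁻¹ • (skewFourier n).conjTranspose) * skewFourier n = 1 := by
    rw [Matrix.smul_mul, skewFourier_conjTranspose_mul, smul_smul, inv_mul_cancel₀ hn', one_smul]
  have h2 := mul_eq_one_comm.1 h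
  rw [Matrix.mul_smul] at h2
  rw [← h2, smul_smul, mul_inv_cancel₀ hn', one_smul]

/-- The coefficients of the eigenvalues of `n ^ (-1/2) S_n` in the entries of `S_n`. -/
noncomputable def eigenvalueCoeff (n t r : ℕ) : ℂ := negOneRoot n t ^ r * ((Real.sqrt n)⁻¹ : ℝ)

/-- Row i is summed over columns i + r mod n. When the column wraps around, the factor ω^n = -1
cancels the reversed sign of the entry. -/
theorem skewCirculant_mul_skewFourier (n : ℕ) (s : ℕ → ℝ) :
    ((Real.sqrt n)⁻¹ • skewCirculant n s).map Complex.ofReal * skewFourier n =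
      skewFourier n * Matrix.diagonal fun t : Fin n =>
        ∑ r ∈ Finset.range n, eigenvalueCoeff n t r * (s r : ℂ) := by
  ext i t
  have hn : n ≠ 0 := fun h0 => by subst h0; exact i.elim0
  have : NeZero n := ⟨hn⟩
  rw [Matrix.mul_diagonal, Matrix.mul_apply, Finset.sum_range, Finset.mul_sum,
    ← Equiv.sum_comp (Equiv.addLeft i)]
  refine Finset.sum_congr rfl fun r _ => ?_
  have key : ((skewCirculant n s i (i + r) : ℝ) : ℂ) * negOneRoot n t ^ ((i + r : Fin n) : ℕ) =
      negOneRoot n t ^ (i : ℕ) * (negOneRoot n t ^ (r : ℕ) * s r) := by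
    rw [← mul_assoc, ← pow_add, mul_comm]
    simp only [skewCirculant, Matrix.of_apply, Fin.le_def, Fin.val_add]
    by_cases h : (i : ℕ) + r < n
    · rw [Nat.mod_eq_of_lt h, if_pos (Nat.le_add_right _ _), Nat.add_sub_cancel_left]
    · have hm : ((i : ℕ) + r) % n = i + r - n := by
        rw [Nat.mod_eq_sub_mod (by omega), Nat.mod_eq_of_lt (by omega)]
      have hw : negOneRoot n t ^ ((i : ℕ) + r) = -negOneRoot n t ^ ((i : ℕ) + r - n) := by
        rw [← neg_one_mul, ← negOneRoot_pow_self hn t, ← pow_add]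
        congr 1
        omega
      rw [hm, if_neg (by omega), hw, show n + ((i : ℕ) + r - n) - i = r by omega]
      push_cast
      ring
  simp only [Equiv.coe_addLeft, Matrix.map_apply, Matrix.smul_apply, smul_eq_mul, skewFourier,
    Matrix.of_apply, eigenvalueCoeff, Complex.ofReal_mul]
  rw [mul_assoc, key]
  ring

/-- Taking adjoints in CF = FD and multiplying by F on both sides gives n C*F = n F D*, as F is
unitary up to scale. -/
theorem conjTranspose_mul_skewFourier {n : ℕ} {C : Matrix (Fin n) (Fin n) ℂ} {d : Fin n → ℂ}
    (h : C * skewFourier n = skewFourier n * Matrix.diagonal d) :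
    C.conjTranspose * skewFourier n = skewFourier n * Matrix.diagonal fun t => conj (d t) := by
  rcases Nat.eq_zero_or_pos n with rfl | hn
  · ext i; exact i.elim0
  have hn' : (n : ℂ) ≠ 0 := by exact_mod_cast hn.ne'
  have h1 := congrArg (fun M => skewFourier n * M.conjTranspose * skewFourier n) h
  simp only [Matrix.conjTranspose_mul, Matrix.diagonal_conjTranspose] at h1
  rw [← mul_assoc (skewFourier n), skewFourier_mul_conjTranspose, mul_assoc (skewFourier n),
    mul_assoc (Matrix.diagonal _), skewFourier_conjTranspose_mul] at h1
  simp only [Matrix.smul_mul, Matrix.mul_smul, one_mul, mul_one] at h1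
  exact smul_right_injective _ hn' h1

theorem trace_starMonomial {n k : ℕ} {C : Fin k → Matrix (Fin n) (Fin n) ℂ} {d : Fin k → Fin n → ℂ}
    (h : ∀ j, C j * skewFourier n = skewFourier n * Matrix.diagonal (d j))
    (w : List (Fin k × Bool)) :
    (starMonomial C w).trace =
      ∑ t, ∏ j, mixedPow (w.count (j, false)) (w.count (j, true)) (d j t) := by
  have hw : starMonomial C w * skewFourier n = skewFourier n * Matrix.diagonal fun t =>
      (w.map fun l => if l.2 then conj (d l.1 t) else d l.1 t).prod := by
    induction w with
    | nil => simp [starMonomial]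
    | cons l w ih =>
      have hc : starMonomial C (l :: w) =
          (if l.2 then star (C l.1) else C l.1) * starMonomial C w := by
        simp [starMonomial]
      have hl : (if l.2 then star (C l.1) else C l.1) * skewFourier n =
          skewFourier n * Matrix.diagonal fun t => if l.2 then conj (d l.1 t) else d l.1 t := by
        split_ifs
        · exact conjTranspose_mul_skewFourier (h l.1)
        · exact h l.1
      rw [hc, mul_assoc, ih, ← mul_assoc, hl, mul_assoc, Matrix.diagonal_mul_diagonal]
      simp
  rcases Nat.eq_zero_or_pos n with rfl | hn
  · simp [Matrix.trace]
  have hn' : (n : ℂ) ≠ 0 := by exact_mod_cast hn.ne'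
  have e : (n : ℂ) • (starMonomial C w).trace = (n : ℂ) • (Matrix.diagonal fun t =>
      (w.map fun l => if l.2 then conj (d l.1 t) else d l.1 t).prod).trace := by
    rw [← Matrix.trace_smul, ← Matrix.trace_smul, ← mul_one (starMonomial C w),
      ← Matrix.mul_smul, ← skewFourier_mul_conjTranspose, ← mul_assoc, hw, mul_assoc,
      Matrix.trace_mul_comm, mul_assoc, skewFourier_conjTranspose_mul, Matrix.mul_smul, mul_one]
  rw [smul_right_injective _ hn' e, Matrix.trace_diagonal]
  refine Finset.sum_congr rfl fun t _ => ?_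
  rw [List.prod_map_prod_bool]
  simp [mixedPow]

/-! ### Coefficients of the eigenvalues -/

theorem smallCoeffs_eigenvalueCoeff {n : ℕ} (hn : n ≠ 0) (t : ℕ) :
    SmallCoeffs (eigenvalueCoeff n t) (Real.sqrt n)⁻¹ (Finset.range n) := by
  have hn1 : (1 : ℝ) ≤ n := by exact_mod_cast Nat.one_le_iff_ne_zero.2 hn
  refine ⟨by positivity, inv_le_one_of_one_le₀ (Real.one_le_sqrt.2 hn1), fun r _ => ?_, ?_⟩
  · rw [eigenvalueCoeff, norm_mul, norm_pow, norm_negOneRoot, one_pow, one_mul, Complex.norm_real,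
      Real.norm_of_nonneg (by positivity)]
  · rw [Finset.card_range, inv_pow, Real.sq_sqrt (by positivity), mul_inv_cancel₀ (by positivity)]

theorem sum_norm_eigenvalueCoeff_sq {n : ℕ} (hn : n ≠ 0) (t : ℕ) :
    ∑ r ∈ Finset.range n, ‖eigenvalueCoeff n t r‖ ^ 2 = 1 := by
  have hn1 : (n : ℝ) ≠ 0 := by exact_mod_cast hn
  have : ∀ r, ‖eigenvalueCoeff n t r‖ ^ 2 = (n : ℝ)⁻¹ := fun r => by
    rw [eigenvalueCoeff, norm_mul, norm_pow, norm_negOneRoot, one_pow, one_mul, Complex.norm_real,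
      Real.norm_of_nonneg (by positivity), inv_pow, Real.sq_sqrt (by positivity)]
  simp [this, hn1]

/-- Since ω² is an n-th root of unity, the geometric sum vanishes unless ω² = 1. The root ω = 1 is
excluded by ω^n = -1, which leaves ω = -1, where the triangle inequality suffices. -/
theorem norm_sum_eigenvalueCoeff_sq_le {n : ℕ} (hn : n ≠ 0) (t : ℕ) :
    ‖∑ r ∈ Finset.range n, eigenvalueCoeff n t r ^ 2‖ ≤ if negOneRoot n t = -1 then 1 else 0 := by
  split_ifs with h
  · refine (norm_sum_le _ _).trans_eq ?_
    simp_rw [norm_pow]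
    exact sum_norm_eigenvalueCoeff_sq hn t
  · have hne : negOneRoot n t ^ 2 ≠ 1 := by
      intro h2
      rcases sq_eq_one_iff.1 h2 with h1 | h1
      · have := negOneRoot_pow_self hn t
        rw [h1, one_pow] at this
        norm_num at this
      · exact h h1
    have e : ∑ r ∈ Finset.range n, eigenvalueCoeff n t r ^ 2 =
        (∑ r ∈ Finset.range n, (negOneRoot n t ^ 2) ^ r) * (((Real.sqrt n)⁻¹ : ℝ) : ℂ) ^ 2 := by
      rw [Finset.sum_mul]
      refine Finset.sum_congr rfl fun r _ => ?_
      rw [eigenvalueCoeff, mul_pow, ← pow_mul, ← pow_mul, mul_comm r]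
    rw [e, geom_sum_eq_zero_of_pow_eq_one hne, zero_mul, norm_zero]
    rw [← pow_mul, mul_comm, pow_mul, negOneRoot_pow_self hn]
    norm_num

theorem sum_norm_sum_eigenvalueCoeff_sq_le {n : ℕ} (hn : n ≠ 0) :
    ∑ t : Fin n, ‖∑ r ∈ Finset.range n, eigenvalueCoeff n t r ^ 2‖ ≤ 1 := by
  refine (Finset.sum_le_sum fun (t : Fin n) _ => norm_sum_eigenvalueCoeff_sq_le hn t).trans ?_
  rw [Finset.sum_boole]
  have : (Finset.univ.filter fun t : Fin n => negOneRoot n t = -1).card ≤ 1 :=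
    Finset.card_le_one.2 fun t ht u hu => negOneRoot_injective n <| by
      simp only [Finset.mem_filter, Finset.mem_univ, true_and] at ht hu
      exact ht.trans hu.symm
  exact_mod_cast this

/-! ### Averaging over the eigenvalues -/

theorem norm_prod_sub_prod_le {ι : Type*} (S : Finset ι) {a b : ι → ℂ} {B : ℝ} (hB : 1 ≤ B)
    (ha : ∀ i ∈ S, ‖a i‖ ≤ B) (hb : ∀ i ∈ S, ‖b i‖ ≤ B) :
    ‖∏ i ∈ S, a i - ∏ i ∈ S, b i‖ ≤ B ^ S.card * ∑ i ∈ S, ‖a i - b i‖ := by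
  classical
  induction S using Finset.induction_on with
  | empty => simp
  | insert i S hi ih =>
    have hB0 : 0 ≤ B := by linarith
    rw [Finset.prod_insert hi, Finset.prod_insert hi, Finset.sum_insert hi,
      Finset.card_insert_of_notMem hi]
    have ih' := ih (fun j hj => ha j (Finset.mem_insert_of_mem hj))
      (fun j hj => hb j (Finset.mem_insert_of_mem hj))
    have hpa : ‖∏ j ∈ S, a j‖ ≤ B ^ S.card := by
      rw [norm_prod]
      exact (Finset.prod_le_prod (fun j _ => norm_nonneg (a j))
        fun j hj => ha j (Finset.mem_insert_of_mem hj)).trans_eq (Finset.prod_const B)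
    have e : a i * ∏ j ∈ S, a j - b i * ∏ j ∈ S, b j =
        (a i - b i) * ∏ j ∈ S, a j + b i * (∏ j ∈ S, a j - ∏ j ∈ S, b j) := by ring
    rw [e]
    calc _ ≤ ‖a i - b i‖ * B ^ S.card + B * (B ^ S.card * ∑ j ∈ S, ‖a j - b j‖) := by
          refine norm_add_le_of_le ?_ ?_ <;> rw [norm_mul]
          · gcongr
          · gcongr
            exact hb i (Finset.mem_insert_self i S)
      _ ≤ ‖a i - b i‖ * B ^ (S.card + 1) + B * (B ^ S.card * ∑ j ∈ S, ‖a j - b j‖) := by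
          gcongr
          exact Nat.le_succ _
      _ = _ := by ring

theorem MemAllLp.finset_prod {Ω ι R : Type*} [MeasurableSpace Ω] {μ : Measure Ω}
    [IsFiniteMeasure μ] [NormedCommRing R] (S : Finset ι) {f : ι → Ω → R}
    (hf : ∀ i ∈ S, MemAllLp (f i) μ) : MemAllLp (fun ω => ∏ i ∈ S, f i ω) μ := by
  classical
  induction S using Finset.induction_on with
  | empty => simpa using MemAllLp.const (1 : R)
  | insert i S hi ih =>
    simp only [Finset.prod_insert hi]
    exact (hf i (Finset.mem_insert_self i S)).mul
      (ih fun j hj => hf j (Finset.mem_insert_of_mem hj))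

section

variable {Ω : Type u} [MeasurableSpace Ω] {μ : Measure Ω} [IsProbabilityMeasure μ]
  {k : ℕ} {s : Fin k → ℕ → Ω → ℝ}

/-- The `*`-moments of independent skew-circulant matrices in terms of their eigenvalues. -/
theorem state_starMonomial_scaledSkewCirculant (hs : ∀ j, IsInputSequence (s j) μ)
    (hindep : iIndepFun (fun (j : Fin k) (ω : Ω) (r : ℕ) => s j r ω) μ) (n : ℕ+)
    (w : List (Fin k × Bool)) :
    (randomMatrixSpace μ n).state
        (starMonomial (fun j => scaledSkewCirculant μ (s j) (hs j) n) w) =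
      ((n : ℕ) : ℂ)⁻¹ * ∑ t : Fin n, ∏ j, ∫ ω, mixedPow (w.count (j, false)) (w.count (j, true))
        (linearComb (s j) (eigenvalueCoeff n t) (Finset.range n) ω) ∂μ := by
  have htr : ∀ ω, (randomMatricesEval μ n ω
      (starMonomial (fun j => scaledSkewCirculant μ (s j) (hs j) n) w)).trace =
      ∑ t : Fin n, ∏ j, mixedPow (w.count (j, false)) (w.count (j, true))
        (linearComb (s j) (eigenvalueCoeff n t) (Finset.range n) ω) := by
    intro ω
    refine (congrArg Matrix.trace (map_starMonomial (randomMatricesEval μ n ω)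
      (randomMatricesEval_star μ n ω) _ w)).trans ?_
    exact trace_starMonomial (fun j => skewCirculant_mul_skewFourier n fun r => s j r ω) w
  refine (randomMatrixSpace_state μ n _).trans ?_
  refine (congrArg (fun x => ((n : ℕ) : ℂ)⁻¹ * x) (integral_congr_ae (ae_of_all μ htr))).trans ?_
  rw [integral_finsetSum _ fun t _ => (MemAllLp.finset_prod _ fun j _ =>
    ((hs j).memAllLp_linearComb _ _).mixedPow _ _).integrable]
  congr 1
  refine Finset.sum_congr rfl fun t _ => ?_
  -- For fixed t the j-th factor depends only on the j-th sequence, so the expectation factorises.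
  refine hindep.integral_fun_prod_comp
    (f := fun j (x : ℕ → ℝ) => mixedPow (w.count (j, false)) (w.count (j, true))
      (∑ r ∈ Finset.range n, eigenvalueCoeff n t r * (x r : ℂ)))
    (fun j => (measurable_pi_lambda _ fun r => (hs j).measurable r).aemeasurable) fun j => ?_
  exact ((continuous_mixedPow _ _).measurable.comp (by fun_prop)).aestronglyMeasurable

theorem exists_norm_state_sub_le (hs : ∀ j, IsInputSequence (s j) μ)
    (hindep : iIndepFun (fun (j : Fin k) (ω : Ω) (r : ℕ) => s j r ω) μ)
    (w : List (Fin k × Bool)) :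
    ∃ D : ℝ, ∀ n : ℕ+, ‖(randomMatrixSpace μ n).state
        (starMonomial (fun j => scaledSkewCirculant μ (s j) (hs j) n) w) -
      ∏ j, (if w.count (j, false) = w.count (j, true)
        then ((w.count (j, false)).factorial : ℂ) else 0)‖ ≤ D * (Real.sqrt n)⁻¹ := by
  choose C hC0 hC using fun j => (hs j).exists_norm_moment_sub_factorial_le
    (w.count (j, false)) (w.count (j, true))
  choose B hB0 hB using fun j => (hs j).exists_norm_moment_bound
    (w.count (j, false)) (w.count (j, true))
  let g : Fin k → ℂ := fun j => if w.count (j, false) = w.count (j, true)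
        then ((w.count (j, false)).factorial : ℂ) else 0
  -- One bound, at least 1, for all moments and all their limits, as needed to compare the two
  -- products.
  let b : ℝ := 1 + ∑ j, (B j + ‖g j‖)
  have hb : ∀ j, B j + ‖g j‖ ≤ b := fun j => by
    have := Finset.single_le_sum (f := fun j => B j + ‖g j‖)
      (fun j _ => add_nonneg (hB0 j) (norm_nonneg (g j))) (Finset.mem_univ j)
    simp only [b]
    linarith
  have hb1 : 1 ≤ b := by
    have : 0 ≤ ∑ j, (B j + ‖g j‖) :=
      Finset.sum_nonneg fun j _ => add_nonneg (hB0 j) (norm_nonneg (g j))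
    simp only [b]
    linarith
  let D : ℝ := b ^ k * ∑ j, C j
  have hD0 : 0 ≤ D := mul_nonneg (pow_nonneg (by linarith) _) (Finset.sum_nonneg fun j _ => hC0 j)
  -- The defects ∑ (c r)² add up to at most 1 over all t, contributing D/n ≤ Dδ after averaging; the
  -- δ terms contribute another Dδ.
  refine ⟨D * 2, fun n => ?_⟩
  have hn : (n : ℕ) ≠ 0 := n.ne_zero
  have hn1 : (1 : ℝ) ≤ (n : ℕ) := by exact_mod_cast n.pos
  have hnc : ((n : ℕ) : ℂ) ≠ 0 := by exact_mod_cast hn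
  set δ : ℝ := (Real.sqrt (n : ℕ))⁻¹ with hδ
  have hterm : ∀ t : Fin n, ‖∏ j, ∫ ω, mixedPow (w.count (j, false)) (w.count (j, true))
        (linearComb (s j) (eigenvalueCoeff n t) (Finset.range n) ω) ∂μ - ∏ j, g j‖ ≤
      D * (‖∑ r ∈ Finset.range n, eigenvalueCoeff n t r ^ 2‖ + δ) := by
    intro t
    have hsm := smallCoeffs_eigenvalueCoeff hn t
    have hsq := sum_norm_eigenvalueCoeff_sq hn t
    refine (norm_prod_sub_prod_le Finset.univ hb1 (fun j _ => ?_) fun j _ => ?_).trans ?_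
    · exact (hB j _ _ _ hsm).trans (by linarith [hb j, norm_nonneg (g j)])
    · linarith [hb j, hB0 j]
    · rw [Finset.card_univ, Fintype.card_fin]
      simp only [D]
      rw [mul_assoc, Finset.sum_mul]
      gcongr with j
      exact hC j _ _ _ hsm hsq
  rw [state_starMonomial_scaledSkewCirculant hs hindep]
  have e : ∏ j, g j = ((n : ℕ) : ℂ)⁻¹ * ∑ t : Fin n, ∏ j, g j := by
    rw [Finset.sum_const, Finset.card_univ, Fintype.card_fin, nsmul_eq_mul,
      inv_mul_cancel_left₀ hnc]
  change ‖_ - ∏ j, g j‖ ≤ _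
  rw [e, ← mul_sub, ← Finset.sum_sub_distrib, norm_mul, norm_inv, Complex.norm_natCast]
  have hsum := (norm_sum_le_of_le Finset.univ fun t (_ : t ∈ Finset.univ) => hterm t)
  have hA := sum_norm_sum_eigenvalueCoeff_sq_le hn
  rw [← Finset.mul_sum, Finset.sum_add_distrib, Finset.sum_const, Finset.card_univ,
    Fintype.card_fin, nsmul_eq_mul] at hsum
  have hinv : ((n : ℕ) : ℝ)⁻¹ ≤ δ :=
    inv_anti₀ (by positivity) (Real.sqrt_le_iff.2 ⟨by positivity, by nlinarith⟩)
  calc _ ≤ ((n : ℕ) : ℝ)⁻¹ * (D * (1 + (n : ℕ) * δ)) := by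
        gcongr
        exact hsum.trans (by gcongr)
    _ = D * (((n : ℕ) : ℝ)⁻¹ + δ) := by field_simp
    _ ≤ D * (δ + δ) := by gcongr
    _ = D * 2 * δ := by ring

end

theorem theorem3p2 {Ω : Type u} [MeasurableSpace Ω] (μ : Measure Ω) [IsProbabilityMeasure μ]
    (k : ℕ) (s : Fin k → ℕ → Ω → ℝ)
    (hs : ∀ j, IsInputSequence (s j) μ)
    (hindep : iIndepFun (fun (j : Fin k) (ω : Ω) (r : ℕ) => s j r ω) μ) :
    (∃ (B : StarProbSpace.{0}) (N : Fin k → B.carrier),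
      (∀ j, IsStandardComplexGaussian B (N j)) ∧ StarIndependent B N) ∧
    ∀ (B : StarProbSpace.{v}) (N : Fin k → B.carrier),
      (∀ j, IsStandardComplexGaussian B (N j)) → StarIndependent B N →
      ConvergesInStarDistribution (fun n => randomMatrixSpace μ n)
        (fun n j => scaledSkewCirculant μ (s j) (hs j) n) B N := by
  refine ⟨exists_independent_standardComplexGaussian k, fun B N hN hI w => ?_⟩
  rw [hI.state_starMonomial hN]
  obtain ⟨D, hD⟩ := exists_norm_state_sub_le hs hindep w
  refine tendsto_iff_norm_sub_tendsto_zero.2 (squeeze_zero (fun n => norm_nonneg _) hD ?_)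
  have h : Tendsto (fun n : ℕ+ => ((n : ℕ) : ℝ)) atTop atTop :=
    tendsto_natCast_atTop_atTop.comp tendsto_PNat_val_atTop_atTop
  simpa using (tendsto_inv_atTop_zero.comp (Real.tendsto_sqrt_atTop.comp h)).const_mul D
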